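/- A map between Banach lattices is called a lattice embedding if it is a linear isometry (into) that preserves finite suprema and infima, and a lattice automorphism of $X$ is a surjective lattice embedding $X\to X$. For $1\le p,q<\infty$ let $L_p(L_q)=L_p([0,1];L_q([0,1]))$ with Lebesgue measure, the pointwise almost everywhere order and the norm $\|f\|=\big(\int_0^1\|f(x)\|_{L_q}^p\,dx\big)^{1/p}$. A $BL_pL_q$ lattice is a Banach lattice that is isometrically lattice isomorphic to a band of $L_p(\Omega;L_q(\Omega'))$ for some measure spaces $\Omega,\Omega'$. Let $B\mathcal K_{p,q}$ be the class of finite-dimensional $BL_pL_q$ lattices. Theorem. Let $1\le p\ne q<\infty$. Then $L_p(L_q)$ is approximately ultrahomogeneous over $B\mathcal K_{p,q}$: for every $E\in B\mathcal K_{p,q}$, all $e_1,\dots,e_n$ generating $E$ as a Banach lattice, all lattice embeddings $f_1,f_2:E\to L_p(L_q)$, and every $\varepsilon>0$, there is a lattice automorphism $\phi$ of $L_p(L_q)$ such that $\|\phi(f_1(e_j))-f_2(e_j)\|<\varepsilon$ for every $1\le j\le n$. -/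

import Mathlib

open MeasureTheory Set
open scoped ENNReal

universe u v w

/-- A map between lattices that preserves binary suprema and infima. -/
def PreservesLattice {E : Type u} {F : Type v} [Lattice E] [Lattice F] (f : E → F) : Prop :=
  (∀ x y, f (x ⊔ y) = f x ⊔ f y) ∧ (∀ x y, f (x ⊓ y) = f x ⊓ f y)

/-- A band in a vector lattice: a solid linear subspace that contains the supremum of each of its
nonempty subsets whose supremum exists in the whole space. -/
structure IsBand {X : Type u} [AddCommGroup X] [Module ℝ X] [Lattice X]
    (B : Submodule ℝ X) : Prop where
  solid : LatticeOrderedAddCommGroup.IsSolid (B : Set X)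
  sup_mem : ∀ S : Set X, S ⊆ (B : Set X) → S.Nonempty → ∀ x : X, IsLUB S x → x ∈ B

/-- The elements `e i` generate `E` as a Banach lattice: the only closed vector sublattice that
contains all of them is `E` itself. -/
def GeneratesLattice {E : Type u} [NormedAddCommGroup E] [NormedSpace ℝ E] [Lattice E]
    {ι : Type v} (e : ι → E) : Prop :=
  ∀ S : Submodule ℝ E, IsClosed (S : Set E) →
    (∀ x ∈ S, ∀ y ∈ S, x ⊔ y ∈ S) → (∀ x ∈ S, ∀ y ∈ S, x ⊓ y ∈ S) →
    (∀ i, e i ∈ S) → S = ⊤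

/-- The Banach lattice `X` is approximately ultrahomogeneous over the class `G` of Banach lattices:
any two isometric lattice embeddings into `X` of a member of `G` agree, up to `ε` on a given finite
generating family and up to an isometric lattice automorphism of `X`. -/
def IsAUH (X : Type u) [NormedAddCommGroup X] [NormedSpace ℝ X] [Lattice X]
    (G : ∀ (E : Type v) [NormedAddCommGroup E] [NormedSpace ℝ E] [Lattice E], Prop) : Prop :=
  ∀ (E : Type v) [NormedAddCommGroup E] [NormedSpace ℝ E] [Lattice E]
    [IsOrderedAddMonoid E] [IsOrderedModule ℝ E] [HasSolidNorm E] [CompleteSpace E],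
    G E →
    ∀ (n : ℕ) (e : Fin n → E), GeneratesLattice e →
    ∀ f₁ f₂ : E →ₗᵢ[ℝ] X, PreservesLattice f₁ → PreservesLattice f₂ →
    ∀ ε : ℝ, 0 < ε →
      ∃ φ : X ≃ₗᵢ[ℝ] X, PreservesLattice φ ∧ ∀ j, ‖φ (f₁ (e j)) - f₂ (e j)‖ < ε

/-- `E` is a `BL_pL_q` lattice: it is lattice isometric to a band of `L_p(Ω; L_q(Ω'))` for some
measure spaces `Ω` and `Ω'`. -/
def IsBLpLq (p q : ℝ≥0∞) [Fact (1 ≤ p)] [Fact (1 ≤ q)]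
    (E : Type u) [NormedAddCommGroup E] [NormedSpace ℝ E] [Lattice E] : Prop :=
  ∃ (Ω : Type v) (_ : MeasurableSpace Ω) (μ : Measure Ω)
    (Ω' : Type w) (_ : MeasurableSpace Ω') (ν : Measure Ω')
    (T : E →ₗᵢ[ℝ] Lp (Lp ℝ q ν) p μ),
    PreservesLattice T ∧ IsBand T.toLinearMap.range

/-- The class of finite-dimensional `BL_pL_q` lattices. -/
def IsFinDimBLpLq (p q : ℝ≥0∞) [Fact (1 ≤ p)] [Fact (1 ≤ q)]
    (E : Type u) [NormedAddCommGroup E] [NormedSpace ℝ E] [Lattice E] : Prop :=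
  FiniteDimensional ℝ E ∧ IsBLpLq.{u, v, w} p q E

/-- Lebesgue measure on the unit interval. -/
noncomputable abbrev lebesgueUnit : Measure ℝ := volume.restrict (Icc 0 1)

/-- The Banach lattice `L_p(L_q) = L_p([0,1]; L_q([0,1]))`. -/
abbrev LpLq (p q : ℝ≥0∞) [Fact (1 ≤ p)] [Fact (1 ≤ q)] : Type :=
  Lp (Lp ℝ q lebesgueUnit) p lebesgueUnit

/-!
`E` has a basis of pairwise disjoint normalized atoms. Realize `E` as a band of `L_p(Ω; L_q(Ω'))`.
An atom of a band cannot be cut by a measurable subset of the base `Ω`, so two atoms either have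
disjoint base supports or have fibres of equal norm at almost every point. Since `p ≠ q`, the map
`t ↦ t ^ (p / q)` is strictly convex and superadditive, or strictly concave and subadditive, so the
norm of the sum of the two atoms tells which alternative holds. Hence every lattice embedding of
`E` into `L_p(L_q)` has the same block pattern: almost every fibre lives on a single block of
atoms, which it sends to pairwise disjoint functions of equal norm.

Such an image is close to one with finitely many fibres, each of full support. On these, measure
isomorphisms of the fibres and of the base, weighted to be isometric, carry a model depending only
on the block pattern onto the image. Passing from the first image back to the model and on to the
second gives `φ`.
-/

/-- `F` and `G` are mutually inverse isomorphisms of measure spaces, up to null sets. -/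
structure AEIso {α β : Type*} [MeasurableSpace α] [MeasurableSpace β]
    (μ : Measure α) (ν : Measure β) (F : α → β) (G : β → α) : Prop where
  fwd : MeasurePreserving F μ ν
  bwd : MeasurePreserving G ν μ
  left : ∀ᵐ x ∂μ, G (F x) = x
  right : ∀ᵐ y ∂ν, F (G y) = y

namespace AEIso

variable {α β γ : Type*} [MeasurableSpace α] [MeasurableSpace β] [MeasurableSpace γ]
  {μ : Measure α} {ν : Measure β} {ρ : Measure γ}

theorem symm {F : α → β} {G : β → α} (h : AEIso μ ν F G) : AEIso ν μ G F :=
  ⟨h.bwd, h.fwd, h.right, h.left⟩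

theorem trans {F : α → β} {G : β → α} {F' : β → γ} {G' : γ → β}
    (h : AEIso μ ν F G) (h' : AEIso ν ρ F' G') : AEIso μ ρ (F' ∘ F) (G ∘ G') := by
  refine ⟨h'.fwd.comp h.fwd, h.bwd.comp h'.bwd, ?_, ?_⟩
  · filter_upwards [h.left, h.fwd.quasiMeasurePreserving.ae h'.left] with x hx hx'
    simp only [Function.comp_apply, hx', hx]
  · filter_upwards [h'.right, h'.bwd.quasiMeasurePreserving.ae h.right] with x hx hx'
    simp only [Function.comp_apply, hx', hx]

theorem of_ae_inverse {F : α → β} {G : β → α} (hF : MeasurePreserving F μ ν) (hG : Measurable G)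
    (hleft : ∀ᵐ x ∂μ, G (F x) = x) (hright : ∀ᵐ y ∂ν, F (G y) = y) : AEIso μ ν F G := by
  have hGF : G ∘ F =ᵐ[μ] id := hleft
  refine ⟨hF, ⟨hG, ?_⟩, hleft, hright⟩
  rw [← hF.map_eq, Measure.map_map hG hF.measurable, Measure.map_congr hGF, Measure.map_id]

end AEIso

section DistributionFunction

variable (μ : Measure ℝ) [IsFiniteMeasure μ]

theorem monotone_measureReal_Iic : Monotone fun x => μ.real (Iic x) := fun _ _ h =>
  measureReal_mono (Iic_subset_Iic.2 h)

theorem tendsto_measureReal_Iic_atTop :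
    Filter.Tendsto (fun x => μ.real (Iic x)) Filter.atTop (nhds (μ.real univ)) :=
  (ENNReal.tendsto_toReal (measure_ne_top μ _)).comp (tendsto_measure_Iic_atTop μ)

theorem tendsto_measureReal_Iic_atBot :
    Filter.Tendsto (fun x => μ.real (Iic x)) Filter.atBot (nhds 0) := by
  have h := tendsto_measure_iInter_atBot (μ := μ) (s := fun x : ℝ => Iic x)
    (fun _ => measurableSet_Iic.nullMeasurableSet) (fun _ _ h => Iic_subset_Iic.2 h)
    ⟨0, measure_ne_top μ _⟩
  rw [iInter_Iic_eq_empty_iff.2 (by simp [not_bddBelow_univ]), measure_empty] at h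
  exact (ENNReal.tendsto_toReal ENNReal.zero_ne_top).comp h

variable [NullSingletonClass μ]

theorem continuous_measureReal_Iic : Continuous fun x => μ.real (Iic x) := by
  have hint : (fun x => μ.real (Iic x)) = fun x => ∫ t, (Iic x).indicator 1 t ∂μ := by
    funext x
    rw [integral_indicator_one measurableSet_Iic]
  rw [hint]
  refine continuous_iff_continuousAt.2 fun x₀ =>
    continuousAt_of_dominated (bound := fun _ => 1) ?_ ?_ (integrable_const _) ?_
  · exact .of_forall fun x => (measurable_one.indicator measurableSet_Iic).aestronglyMeasurable
  · exact .of_forall fun x => .of_forall fun t => by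
      by_cases ht : t ∈ Iic x <;> simp [ht]
  · have hne : ∀ᵐ t ∂μ, t ≠ x₀ := by simp [ae_iff]
    filter_upwards [hne] with t ht
    rcases lt_or_gt_of_ne ht with h | h
    · refine (continuousAt_const (y := (1 : ℝ))).congr ?_
      filter_upwards [lt_mem_nhds h] with x hx
      simp [indicator, hx.le]
    · refine (continuousAt_const (y := (0 : ℝ))).congr ?_
      filter_upwards [gt_mem_nhds h] with x hx
      simp [indicator, hx]

theorem exists_measureReal_Iic_eq {a : ℝ} (ha : a ∈ Ioo 0 (μ.real univ)) :
    ∃ x, μ.real (Iic x) = a :=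
  mem_range_of_exists_le_of_exists_ge (continuous_measureReal_Iic μ)
    (((tendsto_measureReal_Iic_atBot μ).eventually (gt_mem_nhds ha.1)).exists.imp fun _ => le_of_lt)
    (((tendsto_measureReal_Iic_atTop μ).eventually (lt_mem_nhds ha.2)).exists.imp fun _ => le_of_lt)

theorem measureReal_setOf_measureReal_Iic_le {a : ℝ} (ha : 0 ≤ a) (haM : a ≤ μ.real univ) :
    μ.real {x | μ.real (Iic x) ≤ a} = a := by
  set S := {x | μ.real (Iic x) ≤ a} with hS
  rcases haM.eq_or_lt with rfl | haM
  · rw [eq_univ_of_forall fun x => show x ∈ S from measureReal_mono (subset_univ _)]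
  refine le_antisymm ?_ ?_
  · rcases S.eq_empty_or_nonempty with hempty | hne
    · simpa [hempty] using ha
    have hbdd : BddAbove S := by
      obtain ⟨b, hb⟩ := ((tendsto_measureReal_Iic_atTop μ).eventually (lt_mem_nhds haM)).exists
      refine ⟨b, fun x hx => le_of_not_gt fun hbx => ?_⟩
      exact (hb.trans_le (monotone_measureReal_Iic μ hbx.le)).not_ge hx
    have hmax : sSup S ∈ S :=
      (isClosed_le (continuous_measureReal_Iic μ) continuous_const).csSup_mem hne hbdd
    exact (measureReal_mono fun x hx => le_csSup hbdd hx).trans hmax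
  · rcases ha.eq_or_lt with rfl | ha
    · exact measureReal_nonneg
    obtain ⟨b, rfl⟩ := exists_measureReal_Iic_eq μ ⟨ha, haM⟩
    exact measureReal_mono fun x hx => monotone_measureReal_Iic μ hx

theorem measurePreserving_measureReal_Iic :
    MeasurePreserving (fun x => μ.real (Iic x)) μ (volume.restrict (Ioo 0 (μ.real univ))) := by
  have hmeas := (continuous_measureReal_Iic μ).measurable
  refine ⟨hmeas, Measure.ext_of_Iic _ _ fun a => ?_⟩
  rw [Measure.map_apply hmeas measurableSet_Iic, restrict_Ioo_eq_restrict_Ioc,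
    Measure.restrict_apply measurableSet_Iic, inter_comm, Ioc_inter_Iic, Real.volume_Ioc, sub_zero]
  rcases lt_or_ge a 0 with ha | ha
  · have hempty : (fun x => μ.real (Iic x)) ⁻¹' Iic a = ∅ :=
      eq_empty_of_forall_notMem fun x hx => (ha.trans_le measureReal_nonneg).not_ge hx
    rw [hempty, measure_empty, ENNReal.ofReal_of_nonpos (inf_le_right.trans ha.le)]
  · have hpre : (fun x => μ.real (Iic x)) ⁻¹' Iic a =
        {x | μ.real (Iic x) ≤ μ.real univ ⊓ a} := by
      ext x
      simp [measureReal_mono (μ := μ) (subset_univ (Iic x))]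
    rw [hpre, ← ofReal_measureReal,
      measureReal_setOf_measureReal_Iic_le μ (le_inf measureReal_nonneg ha) inf_le_left]

theorem exists_aeIso_volume_Ioo :
    ∃ F G, AEIso μ (volume.restrict (Ioo 0 (μ.real univ))) F G := by
  set F : ℝ → ℝ := fun x => μ.real (Iic x)
  have hF : MeasurePreserving F μ _ := measurePreserving_measureReal_Iic μ
  have hF_mono : Monotone F := monotone_measureReal_Iic μ
  choose! G hFG using fun t ht => exists_measureReal_Iic_eq μ (a := t) ht
  have hG_mono : MonotoneOn G (Ioo 0 (μ.real univ)) := by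
    intro s hs t ht hst
    by_contra! hlt
    have hts : t ≤ s := by simpa only [F, hFG s hs, hFG t ht] using hF_mono hlt.le
    rw [hst.antisymm hts] at hlt
    exact lt_irrefl _ hlt
  have hG := aemeasurable_restrict_of_monotoneOn (μ := volume) measurableSet_Ioo hG_mono
  refine ⟨F, hG.mk G, .of_ae_inverse hF hG.measurable_mk ?_ ?_⟩
  · -- `G (F x) ≠ x` forces `F` to be constant between `x` and some rational number.
    have hrat : ∀ᵐ x ∂μ, ∀ r : ℚ, F x ≠ F r :=
      ae_all_iff.2 fun r => hF.quasiMeasurePreserving.ae (p := fun y => y ≠ F r)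
        (ae_restrict_of_ae (Measure.ae_ne volume (F r)))
    filter_upwards [hrat, hF.quasiMeasurePreserving.ae hG.ae_eq_mk,
      hF.quasiMeasurePreserving.ae (ae_restrict_mem measurableSet_Ioo)] with x hx hmk hmem
    have hFGF : F (G (F x)) = F x := hFG _ hmem
    rw [← hmk]
    by_contra hne
    rcases lt_or_gt_of_ne hne with hlt | hlt
    all_goals
      obtain ⟨r, hr, hr'⟩ := exists_rat_btwn hlt
      have h₁ := hF_mono hr.le
      have h₂ := hF_mono hr'.le
      exact hx r (by linarith)
  · filter_upwards [hG.ae_eq_mk, ae_restrict_mem measurableSet_Ioo] with t hmk ht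
    rw [← hmk]
    exact hFG t ht

end DistributionFunction

theorem exists_aeIso (μ ν : Measure ℝ) [IsFiniteMeasure μ] [NullSingletonClass μ]
    [IsFiniteMeasure ν] [NullSingletonClass ν] (h : μ univ = ν univ) : ∃ F G, AEIso μ ν F G := by
  obtain ⟨F, G, hFG⟩ := exists_aeIso_volume_Ioo μ
  obtain ⟨F', G', hFG'⟩ := exists_aeIso_volume_Ioo ν
  rw [show μ.real univ = ν.real univ by rw [Measure.real, Measure.real, h]] at hFG
  exact ⟨_, _, hFG.trans hFG'.symm⟩

section Glue

variable {α β K : Type*} [MeasurableSpace α] [MeasurableSpace β] [Countable K] [MeasurableSpace K]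
  [MeasurableSingletonClass K]

theorem measure_sum_restrict_fiber (μ : Measure α) {κ : α → K} (hκ : Measurable κ) :
    Measure.sum (fun k => μ.restrict (κ ⁻¹' {k})) = μ := by
  rw [← Measure.restrict_iUnion (pairwise_disjoint_fiber κ)
    fun k => hκ (measurableSet_singleton k), ← preimage_iUnion, iUnion_of_singleton,
    preimage_univ, Measure.restrict_univ]

theorem ae_of_forall_ae_restrict_fiber {μ : Measure α} {κ : α → K} (hκ : Measurable κ)
    {P : K → α → Prop} (h : ∀ k, ∀ᵐ x ∂μ.restrict (κ ⁻¹' {k}), P k x) : ∀ᵐ x ∂μ, P (κ x) x := by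
  filter_upwards [ae_all_iff.2 fun k =>
    (ae_restrict_iff' (hκ (measurableSet_singleton k))).1 (h k)] with x hx
  exact hx (κ x) rfl

theorem measurable_glue {κ : α → K} (hκ : Measurable κ) {F : K → α → β}
    (hF : ∀ k, Measurable (F k)) : Measurable fun x => F (κ x) x :=
  (measurable_from_prod_countable_right (f := fun z : K × α => F z.1 z.2) hF).comp
    (hκ.prodMk measurable_id)

theorem measurePreserving_glue {μ : Measure α} {ν : Measure β} {κ : α → K} {κ' : β → K}
    (hκ : Measurable κ) (hκ' : Measurable κ') {F : K → α → β}
    (hF : ∀ k, MeasurePreserving (F k) (μ.restrict (κ ⁻¹' {k})) (ν.restrict (κ' ⁻¹' {k}))) :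
    MeasurePreserving (fun x => F (κ x) x) μ ν := by
  have hmeas := measurable_glue hκ fun k => (hF k).measurable
  refine ⟨hmeas, ?_⟩
  rw [← measure_sum_restrict_fiber μ hκ, ← measure_sum_restrict_fiber ν hκ',
    Measure.map_sum hmeas.aemeasurable]
  congr 1
  funext k
  rw [← (hF k).map_eq]
  refine Measure.map_congr ?_
  filter_upwards [ae_restrict_mem (hκ (measurableSet_singleton k))] with x hx
  rw [show κ x = k from hx]

theorem ae_glue_mem_fiber {μ : Measure α} {ν : Measure β} {κ : α → K} {κ' : β → K}
    (hκ : Measurable κ) (hκ' : Measurable κ') {F : K → α → β}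
    (hF : ∀ k, MeasurePreserving (F k) (μ.restrict (κ ⁻¹' {k})) (ν.restrict (κ' ⁻¹' {k}))) :
    ∀ᵐ x ∂μ, κ' (F (κ x) x) = κ x :=
  ae_of_forall_ae_restrict_fiber (P := fun k x => κ' (F k x) = k) hκ fun k =>
    (hF k).quasiMeasurePreserving.ae (ae_restrict_mem (hκ' (measurableSet_singleton k)))

theorem ae_glue_leftInverse {μ : Measure α} {ν : Measure β} {κ : α → K} {κ' : β → K}
    (hκ : Measurable κ) (hκ' : Measurable κ') {F : K → α → β} {G : K → β → α}
    (hFG : ∀ k, AEIso (μ.restrict (κ ⁻¹' {k})) (ν.restrict (κ' ⁻¹' {k})) (F k) (G k)) :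
    ∀ᵐ x ∂μ, G (κ' (F (κ x) x)) (F (κ x) x) = x := by
  filter_upwards [ae_glue_mem_fiber hκ hκ' fun k => (hFG k).fwd,
    ae_of_forall_ae_restrict_fiber (P := fun k x => G k (F k x) = x) hκ fun k => (hFG k).left]
    with x hx hGF
  rw [hx, hGF]

theorem exists_aeIso_partition (μ ν : Measure ℝ) [IsFiniteMeasure μ] [NullSingletonClass μ]
    [IsFiniteMeasure ν] [NullSingletonClass ν] {κ κ' : ℝ → K} (hκ : Measurable κ)
    (hκ' : Measurable κ') (h : ∀ k, μ (κ ⁻¹' {k}) = ν (κ' ⁻¹' {k})) :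
    ∃ F G, AEIso μ ν F G ∧ ∀ᵐ x ∂μ, κ' (F x) = κ x := by
  choose F G hFG using fun k =>
    exists_aeIso (μ.restrict (κ ⁻¹' {k})) (ν.restrict (κ' ⁻¹' {k})) (by simpa using h k)
  exact ⟨_, _, ⟨measurePreserving_glue hκ hκ' fun k => (hFG k).fwd,
    measurePreserving_glue hκ' hκ fun k => (hFG k).bwd, ae_glue_leftInverse hκ hκ' hFG,
    ae_glue_leftInverse hκ' hκ fun k => (hFG k).symm⟩,
    ae_glue_mem_fiber hκ hκ' fun k => (hFG k).fwd⟩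

end Glue

theorem exists_measurable_partition (K : Type*) [Finite K] [Nonempty K] [MeasurableSpace K] :
    ∃ θ : ℝ → K, Measurable θ ∧ ∀ k, lebesgueUnit (θ ⁻¹' {k}) ≠ 0 := by
  have : Infinite (Ioo (0 : ℝ) 1) := (Ioo_infinite zero_lt_one).to_subtype
  obtain ⟨c⟩ : Nonempty (K ↪ Ioo (0 : ℝ) 1) :=
    ⟨(Finite.equivFin K).toEmbedding.trans (Fin.valEmbedding.trans (Infinite.natEmbedding _))⟩
  have hc : Function.Injective fun k => (c k : ℝ) := Subtype.val_injective.comp c.injective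
  obtain ⟨U, hU, hdisj⟩ := (finite_range fun k => (c k : ℝ)).t2_separation
  obtain ⟨θ, hθ, hθU⟩ := exists_measurable_piecewise (fun k => U (c k))
    (fun k => (hU (c k)).2.measurableSet) (fun k _ => k) (fun _ => measurable_const)
    fun i j hij x hx => ((hdisj (mem_range_self i) (mem_range_self j) (hc.ne hij)).le_bot hx).elim
  refine ⟨θ, hθ, fun k => ne_of_gt ?_⟩
  have hsub : U (c k) ∩ Ioo 0 1 ⊆ θ ⁻¹' {k} ∩ Icc 0 1 :=
    inter_subset_inter (fun x hx => hθU k hx) Ioo_subset_Icc_self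
  have hpos : 0 < volume (U (c k) ∩ Ioo 0 1) :=
    ((hU (c k)).2.inter isOpen_Ioo).measure_pos volume ⟨c k, (hU (c k)).1, (c k).2⟩
  exact hpos.trans_le ((measure_mono hsub).trans (Measure.le_restrict_apply _ _))

section PointwiseIsometry

variable {α X : Type*} [MeasurableSpace α] {μ : Measure α} [NormedAddCommGroup X]
  [NormedSpace ℝ X] {p : ℝ≥0∞}

/-- A linear operator on functions that induces a linear isometry of `L_p(μ; X)`. -/
structure InducesLpIsometry (p : ℝ≥0∞) (μ : Measure α) (Φ : (α → X) →ₗ[ℝ] (α → X)) : Prop where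
  congr_ae : ∀ {f g : α → X}, f =ᵐ[μ] g → Φ f =ᵐ[μ] Φ g
  stronglyMeasurable : ∀ {f : α → X}, StronglyMeasurable f → StronglyMeasurable (Φ f)
  eLpNorm_eq : ∀ {f : α → X}, StronglyMeasurable f → eLpNorm (Φ f) p μ = eLpNorm f p μ

namespace InducesLpIsometry

variable {Φ : (α → X) →ₗ[ℝ] (α → X)}

theorem memLp_iff (h : InducesLpIsometry p μ Φ) {f : α → X} (hf : StronglyMeasurable f) :
    MemLp (Φ f) p μ ↔ MemLp f p μ := by
  simp only [MemLp, h.eLpNorm_eq hf, hf.aestronglyMeasurable,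
    (h.stronglyMeasurable hf).aestronglyMeasurable]

theorem memLp_coeFn (h : InducesLpIsometry p μ Φ) (f : Lp X p μ) : MemLp (Φ f) p μ :=
  (h.memLp_iff (Lp.stronglyMeasurable f)).2 (Lp.memLp f)

variable [Fact (1 ≤ p)]

/-- The isometry of `L_p(μ; X)` induced by `Φ`. -/
noncomputable def toLp (h : InducesLpIsometry p μ Φ) : Lp X p μ →ₗᵢ[ℝ] Lp X p μ where
  toFun f := (h.memLp_coeFn f).toLp
  map_add' f g := by
    rw [← MemLp.toLp_add, MemLp.toLp_eq_toLp_iff, ← map_add]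
    exact h.congr_ae (Lp.coeFn_add f g)
  map_smul' c f := by
    rw [RingHom.id_apply, ← MemLp.toLp_const_smul, MemLp.toLp_eq_toLp_iff, ← map_smul]
    exact h.congr_ae (Lp.coeFn_smul c f)
  norm_map' f := by
    change ‖(h.memLp_coeFn f).toLp‖ = ‖f‖
    rw [Lp.norm_toLp, h.eLpNorm_eq (Lp.stronglyMeasurable f), Lp.norm_def]

theorem coeFn_toLp (h : InducesLpIsometry p μ Φ) (f : Lp X p μ) : h.toLp f =ᵐ[μ] Φ f :=
  (h.memLp_coeFn f).coeFn_toLp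

theorem coeFn_toLp_of_ae_eq (h : InducesLpIsometry p μ Φ) {f : Lp X p μ} {g : α → X}
    (hfg : f =ᵐ[μ] g) : h.toLp f =ᵐ[μ] Φ g :=
  (h.coeFn_toLp f).trans (h.congr_ae hfg)

theorem surjective_toLp (h : InducesLpIsometry p μ Φ)
    (hΦ : ∀ g, StronglyMeasurable g → ∃ f, StronglyMeasurable f ∧ Φ f =ᵐ[μ] g) :
    Function.Surjective h.toLp := by
  intro g
  obtain ⟨f, hf, hfg⟩ := hΦ g (Lp.stronglyMeasurable g)
  have hmem : MemLp f p μ := (h.memLp_iff hf).1 ((memLp_congr_ae hfg).2 (Lp.memLp g))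
  exact ⟨hmem.toLp, Lp.ext ((h.coeFn_toLp_of_ae_eq hmem.coeFn_toLp).trans hfg)⟩

theorem preservesLattice_toLp [Lattice X] [HasSolidNorm X] [IsOrderedAddMonoid X]
    (h : InducesLpIsometry p μ Φ) (hsup : ∀ f g, Φ (f ⊔ g) =ᵐ[μ] Φ f ⊔ Φ g)
    (hinf : ∀ f g, Φ (f ⊓ g) =ᵐ[μ] Φ f ⊓ Φ g) : PreservesLattice h.toLp := by
  refine ⟨fun f g => Lp.ext ?_, fun f g => Lp.ext ?_⟩
  · calc h.toLp (f ⊔ g) =ᵐ[μ] Φ (⇑f ⊔ ⇑g) := h.coeFn_toLp_of_ae_eq (Lp.coeFn_sup f g)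
      _ =ᵐ[μ] Φ f ⊔ Φ g := hsup f g
      _ =ᵐ[μ] h.toLp f ⊔ h.toLp g := ((h.coeFn_toLp f).sup (h.coeFn_toLp g)).symm
      _ =ᵐ[μ] ↑(h.toLp f ⊔ h.toLp g) := (Lp.coeFn_sup _ _).symm
  · calc h.toLp (f ⊓ g) =ᵐ[μ] Φ (⇑f ⊓ ⇑g) := h.coeFn_toLp_of_ae_eq (Lp.coeFn_inf f g)
      _ =ᵐ[μ] Φ f ⊓ Φ g := hinf f g
      _ =ᵐ[μ] h.toLp f ⊓ h.toLp g := ((h.coeFn_toLp f).inf (h.coeFn_toLp g)).symm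
      _ =ᵐ[μ] ↑(h.toLp f ⊓ h.toLp g) := (Lp.coeFn_inf _ _).symm

end InducesLpIsometry

/-- The weighted composition operator with weight `w`, point map `F` and a simple family `ψ` of
isometries of the space of values. -/
def weightedComp (w : α → ℝ) (F : α → α) (ψ : SimpleFunc α (X ≃ₗᵢ[ℝ] X)) :
    (α → X) →ₗ[ℝ] (α → X) where
  toFun f s := w s • ψ s (f (F s))
  map_add' f g := by
    funext s
    simp only [Pi.add_apply, map_add, smul_add]
  map_smul' c f := by
    funext s
    simp only [Pi.smul_apply, map_smul, RingHom.id_apply, smul_comm c]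

theorem weightedComp_apply (w : α → ℝ) (F : α → α) (ψ : SimpleFunc α (X ≃ₗᵢ[ℝ] X)) (f : α → X)
    (s : α) : weightedComp w F ψ f s = w s • ψ s (f (F s)) := rfl

theorem stronglyMeasurable_simpleFunc_apply {α X Y : Type*} [MeasurableSpace α]
    [TopologicalSpace X] [TopologicalSpace Y] (ψ : SimpleFunc α (X → Y))
    (hψ : ∀ s, Continuous (ψ s)) {f : α → X} (hf : StronglyMeasurable f) :
    StronglyMeasurable fun s => ψ s (f s) :=
  ⟨fun n => ψ.seq (hf.approx n), fun s => ((hψ s).tendsto _).comp (hf.tendsto_approx s)⟩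

variable {w : α → ℝ} {F G : α → α} {ψ : SimpleFunc α (X ≃ₗᵢ[ℝ] X)}

theorem eLpNorm_weightedComp (hp0 : p ≠ 0) (hp : p ≠ ∞) (hw : Measurable w)
    (hF : MeasurePreserving F (μ.withDensity fun s => ‖w s‖ₑ ^ p.toReal) μ) {f : α → X}
    (hf : StronglyMeasurable f) : eLpNorm (weightedComp w F ψ f) p μ = eLpNorm f p μ := by
  have hf' : Measurable fun t => ‖f t‖ₑ ^ p.toReal := hf.enorm.pow_const _
  have hdensity : ∫⁻ s, ‖f (F s)‖ₑ ^ p.toReal ∂(μ.withDensity fun s => ‖w s‖ₑ ^ p.toReal) =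
      ∫⁻ s, ‖w s‖ₑ ^ p.toReal * ‖f (F s)‖ₑ ^ p.toReal ∂μ :=
    lintegral_withDensity_eq_lintegral_mul μ (hw.enorm.pow_const _) (hf'.comp hF.measurable)
  rw [eLpNorm_eq_lintegral_rpow_enorm_toReal hp0 hp, eLpNorm_eq_lintegral_rpow_enorm_toReal hp0 hp,
    ← hF.lintegral_comp hf', hdensity]
  simp only [weightedComp_apply, enorm_smul, LinearIsometryEquiv.enorm_map,
    ENNReal.mul_rpow_of_nonneg _ _ ENNReal.toReal_nonneg]

theorem absolutelyContinuous_withDensity_enorm (hw : Measurable w) (hw0 : ∀ᵐ s ∂μ, 0 < w s) :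
    μ ≪ μ.withDensity fun s => ‖w s‖ₑ ^ p.toReal := by
  refine withDensity_absolutelyContinuous' (hw.enorm.pow_const _).aemeasurable ?_
  filter_upwards [hw0] with s hs
  exact (ENNReal.rpow_pos (enorm_pos.2 hs.ne') enorm_ne_top).ne'

theorem inducesLpIsometry_weightedComp (hp0 : p ≠ 0) (hp : p ≠ ∞) (hw : Measurable w)
    (hw0 : ∀ᵐ s ∂μ, 0 < w s)
    (hF : MeasurePreserving F (μ.withDensity fun s => ‖w s‖ₑ ^ p.toReal) μ) :
    InducesLpIsometry p μ (weightedComp w F ψ) where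
  congr_ae hfg := by
    filter_upwards [(absolutelyContinuous_withDensity_enorm hw hw0).ae_le
      (hF.quasiMeasurePreserving.ae hfg)] with s hs
    simp only [weightedComp_apply, hs]
  stronglyMeasurable hf := hw.stronglyMeasurable.smul <| stronglyMeasurable_simpleFunc_apply
    (ψ.map fun T x => T x) (fun s => (ψ s).continuous) (hf.comp_measurable hF.measurable)
  eLpNorm_eq hf := eLpNorm_weightedComp hp0 hp hw hF hf

theorem exists_weightedComp_ae_eq (hw : Measurable w) (hw0 : ∀ᵐ s ∂μ, 0 < w s)
    (hFG : AEIso (μ.withDensity fun s => ‖w s‖ₑ ^ p.toReal) μ F G) {g : α → X}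
    (hg : StronglyMeasurable g) :
    ∃ f, StronglyMeasurable f ∧ weightedComp w F ψ f =ᵐ[μ] g := by
  refine ⟨fun t => (w (G t))⁻¹ • (ψ (G t)).symm (g (G t)), ?_, ?_⟩
  · exact (hw.inv.stronglyMeasurable.smul <| stronglyMeasurable_simpleFunc_apply
      (ψ.map fun T x => T.symm x) (fun s => (ψ s).symm.continuous) hg).comp_measurable
        hFG.bwd.measurable
  · filter_upwards [(absolutelyContinuous_withDensity_enorm hw hw0).ae_le hFG.left, hw0]
      with s hs hs0
    rw [weightedComp_apply, hs, map_smul, LinearIsometryEquiv.apply_symm_apply,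
      smul_inv_smul₀ hs0.ne']

theorem preservesLattice_smul [Lattice X] [IsOrderedAddMonoid X] [IsOrderedModule ℝ X] {c : ℝ}
    (hc : 0 < c) : PreservesLattice fun x : X => c • x :=
  ⟨(OrderIso.smulRight hc).map_sup, (OrderIso.smulRight hc).map_inf⟩

theorem exists_weightedComp_automorphism [Lattice X] [HasSolidNorm X] [IsOrderedAddMonoid X]
    [IsOrderedModule ℝ X] [Fact (1 ≤ p)] (hp : p ≠ ∞) (hw : Measurable w)
    (hw0 : ∀ᵐ s ∂μ, 0 < w s) (hFG : AEIso (μ.withDensity fun s => ‖w s‖ₑ ^ p.toReal) μ F G)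
    (hψ : ∀ s, PreservesLattice (ψ s)) :
    ∃ φ : Lp X p μ ≃ₗᵢ[ℝ] Lp X p μ, PreservesLattice φ ∧
      ∀ (f : Lp X p μ) (g : α → X), f =ᵐ[μ] g → φ f =ᵐ[μ] weightedComp w F ψ g := by
  have hp0 : p ≠ 0 := (zero_lt_one.trans_le (Fact.out : 1 ≤ p)).ne'
  have h : InducesLpIsometry p μ (weightedComp w F ψ) :=
    inducesLpIsometry_weightedComp hp0 hp hw hw0 hFG.fwd
  refine ⟨.ofSurjective h.toLp (h.surjective_toLp fun g hg =>
    exists_weightedComp_ae_eq hw hw0 hFG hg), h.preservesLattice_toLp ?_ ?_,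
    fun f g hfg => h.coeFn_toLp_of_ae_eq hfg⟩
  · intro f g
    filter_upwards [hw0] with s hs
    simp only [weightedComp_apply, Pi.sup_apply, (hψ s).1]
    exact (preservesLattice_smul hs).1 _ _
  · intro f g
    filter_upwards [hw0] with s hs
    simp only [weightedComp_apply, Pi.inf_apply, (hψ s).2]
    exact (preservesLattice_smul hs).2 _ _

end PointwiseIsometry

section NormalizedIndicator

variable {α X : Type*} [MeasurableSpace α] {μ : Measure α} [NormedAddCommGroup X] {p : ℝ≥0∞}

instance isOrderedModule_Lp [NormedSpace ℝ X] [Lattice X] [HasSolidNorm X] [IsOrderedAddMonoid X]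
    [IsOrderedModule ℝ X] : IsOrderedModule ℝ (Lp X p μ) := by
  refine .of_smul_nonneg fun a ha f hf => (Lp.coeFn_nonneg _).1 ?_
  filter_upwards [Lp.coeFn_smul a f, (Lp.coeFn_nonneg f).2 hf] with s hs hfs
  rw [hs]
  exact smul_nonneg ha hfs

theorem lintegral_enorm_rpow_Lp (hp0 : p ≠ 0) (hp : p ≠ ∞) (f : Lp X p μ) :
    ∫⁻ s, ‖f s‖ₑ ^ p.toReal ∂μ = ‖f‖ₑ ^ p.toReal := by
  rw [Lp.enorm_def, eLpNorm_eq_lintegral_rpow_enorm_toReal hp0 hp, ← ENNReal.rpow_mul,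
    one_div_mul_cancel (ENNReal.toReal_pos hp0 hp).ne', ENNReal.rpow_one]

variable [NormedSpace ℝ X] [IsFiniteMeasure μ]

/-- The element of `L_p(μ; X)` that is constant on `s` with direction `c` and vanishes off `s`,
scaled so that its norm is `‖c‖` when `s` is not null. -/
noncomputable def normalizedIndicator (p : ℝ≥0∞) {s : Set α} (hs : MeasurableSet s) (c : X) :
    Lp X p μ :=
  indicatorConstLp p hs (measure_ne_top μ s) ((μ.real s ^ (1 / p.toReal))⁻¹ • c)

theorem norm_normalizedIndicator (hp0 : p ≠ 0) (hp : p ≠ ∞) {s : Set α} (hs : MeasurableSet s)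
    (hs0 : μ s ≠ 0) (c : X) : ‖(normalizedIndicator p hs c : Lp X p μ)‖ = ‖c‖ := by
  have hpos : 0 < μ.real s ^ (1 / p.toReal) :=
    Real.rpow_pos_of_pos (ENNReal.toReal_pos hs0 (measure_ne_top μ s)) _
  rw [normalizedIndicator, norm_indicatorConstLp hp0 hp, norm_smul, norm_inv,
    Real.norm_of_nonneg hpos.le]
  field_simp

theorem coeFn_normalizedIndicator {s : Set α} (hs : MeasurableSet s) (c : X) :
    (normalizedIndicator p hs c : Lp X p μ) =ᵐ[μ]
      s.indicator fun _ => (μ.real s ^ (1 / p.toReal))⁻¹ • c :=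
  indicatorConstLp_coeFn

end NormalizedIndicator

theorem setLIntegral_enorm_const_mul_rpow {α : Type*} [MeasurableSpace α] (μ : Measure α)
    {p : ℝ} (hp : 0 < p) {a : ℝ} (ha : 0 ≤ a) {W : α → ℝ} (hW : Measurable W) (s : Set α)
    (hWs : ∫⁻ x in s, ‖W x‖ₑ ^ p ∂μ = 1) :
    ∫⁻ x in s, ‖a ^ (1 / p) * W x‖ₑ ^ p ∂μ = ENNReal.ofReal a := by
  simp only [enorm_mul, ENNReal.mul_rpow_of_nonneg _ _ hp.le]
  rw [lintegral_const_mul _ (hW.enorm.pow_const _), hWs, mul_one,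
    Real.enorm_of_nonneg (by positivity), ENNReal.ofReal_rpow_of_nonneg (by positivity) hp.le,
    ← Real.rpow_mul ha, one_div_mul_cancel hp.ne', Real.rpow_one]

section Transport

variable {K X : Type*} [Countable K] [MeasurableSpace K] [MeasurableSingletonClass K]

theorem measure_univ_eq_of_fibers {α β : Type*} [MeasurableSpace α] [MeasurableSpace β]
    {μ : Measure α} {ν : Measure β} {κ : α → K} {κ' : β → K} (hκ : Measurable κ)
    (hκ' : Measurable κ') (h : ∀ k, μ (κ ⁻¹' {k}) = ν (κ' ⁻¹' {k})) : μ univ = ν univ := by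
  rw [← measure_sum_restrict_fiber μ hκ, ← measure_sum_restrict_fiber ν hκ']
  simp [h]

theorem exists_automorphism_normalizedIndicator {μ : Measure ℝ} [IsFiniteMeasure μ]
    [NullSingletonClass μ] [NormedAddCommGroup X] [NormedSpace ℝ X] [Lattice X] [HasSolidNorm X]
    [IsOrderedAddMonoid X] [IsOrderedModule ℝ X] {p : ℝ≥0∞} [Fact (1 ≤ p)] (hp : p ≠ ∞)
    {θ τ : ℝ → K} (hθ : Measurable θ) (hθ0 : ∀ k, μ (θ ⁻¹' {k}) ≠ 0) (hτ : Measurable τ)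
    {W : ℝ → ℝ} (hW : Measurable W) (hW0 : ∀ᵐ s ∂μ, 0 < W s)
    (hWτ : ∀ k, ∫⁻ s in τ ⁻¹' {k}, ‖W s‖ₑ ^ p.toReal ∂μ = 1)
    (ψ : SimpleFunc ℝ (X ≃ₗᵢ[ℝ] X)) (hψ : ∀ s, PreservesLattice (ψ s)) :
    ∃ φ : Lp X p μ ≃ₗᵢ[ℝ] Lp X p μ, PreservesLattice φ ∧ ∀ k c,
      φ (normalizedIndicator p (hθ (measurableSet_singleton k)) c) =ᵐ[μ]
        (τ ⁻¹' {k}).indicator fun s => W s • ψ s c := by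
  have hP : 0 < p.toReal :=
    ENNReal.toReal_pos (zero_lt_one.trans_le (Fact.out : 1 ≤ p)).ne' hp
  let a : K → ℝ := fun k => μ.real (θ ⁻¹' {k}) ^ (1 / p.toReal)
  have ha : ∀ k, 0 < a k := fun k =>
    Real.rpow_pos_of_pos (ENNReal.toReal_pos (hθ0 k) (measure_ne_top μ _)) _
  let w : ℝ → ℝ := fun s => a (τ s) * W s
  have hw : Measurable w := ((measurable_of_countable a).comp hτ).mul hW
  have hw0 : ∀ᵐ s ∂μ, 0 < w s := hW0.mono fun s hs => mul_pos (ha _) hs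
  set ρ := μ.withDensity fun s => ‖w s‖ₑ ^ p.toReal with hρ
  have hmass : ∀ k, ρ (τ ⁻¹' {k}) = μ (θ ⁻¹' {k}) := fun k => by
    have hτk := hτ (measurableSet_singleton k)
    have hcell : ∫⁻ s in τ ⁻¹' {k}, ‖w s‖ₑ ^ p.toReal ∂μ =
        ∫⁻ s in τ ⁻¹' {k}, ‖a k * W s‖ₑ ^ p.toReal ∂μ :=
      setLIntegral_congr_fun hτk fun s hs => by simp only [w, show τ s = k from hs]
    rw [hρ, withDensity_apply _ hτk, hcell, setLIntegral_enorm_const_mul_rpow μ hP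
      measureReal_nonneg hW _ (hWτ k), ofReal_measureReal]
  have : IsFiniteMeasure ρ :=
    ⟨(measure_univ_eq_of_fibers hτ hθ hmass).trans_lt (measure_lt_top μ univ)⟩
  obtain ⟨F, G, hFG, hF⟩ := exists_aeIso_partition ρ μ hτ hθ hmass
  obtain ⟨φ, hφ, hφw⟩ := exists_weightedComp_automorphism (ψ := ψ) hp hw hw0 hFG hψ
  refine ⟨φ, hφ, fun k c => ?_⟩
  filter_upwards [hφw _ _ (coeFn_normalizedIndicator (hθ (measurableSet_singleton k)) c),
    (absolutelyContinuous_withDensity_enorm hw hw0).ae_le hF] with s hs hFs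
  rw [hs, weightedComp_apply]
  by_cases hk : τ s = k
  · rw [indicator_of_mem (show F s ∈ θ ⁻¹' {k} from hFs.trans hk),
      indicator_of_mem (show s ∈ τ ⁻¹' {k} from hk), map_smul, smul_smul]
    simp only [w, hk]
    rw [mul_right_comm, mul_inv_cancel₀ (ha k).ne', one_mul]
  · rw [indicator_of_notMem (by simpa [hFs] using hk), indicator_of_notMem (by simpa using hk),
      map_zero, smul_zero]

end Transport

section Disjoint

variable {E : Type*} [AddCommGroup E] [Lattice E]

theorem inf_eq_zero_of_le_left {a b c : E} (h : b ⊓ c = 0) (ha : 0 ≤ a) (hab : a ≤ b) :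
    a ⊓ c = 0 :=
  le_antisymm ((inf_le_inf_right c hab).trans h.le) (le_inf ha (h.ge.trans inf_le_right))

variable [IsOrderedAddMonoid E]

theorem add_inf_eq_zero {a b c : E} (ha : a ⊓ c = 0) (hb : b ⊓ c = 0) : (a + b) ⊓ c = 0 := by
  have ha0 : 0 ≤ a := ha.ge.trans inf_le_left
  have hb0 : 0 ≤ b := hb.ge.trans inf_le_left
  have hle : (a + b) ⊓ c - a ≤ b ⊓ c :=
    le_inf (sub_le_iff_le_add'.2 inf_le_left) ((sub_le_self _ ha0).trans inf_le_right)
  rw [hb, sub_nonpos] at hle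
  exact le_antisymm ((le_inf hle inf_le_right).trans ha.le)
    (le_inf (add_nonneg ha0 hb0) (ha.ge.trans inf_le_right))

theorem sum_inf_eq_zero {ι : Type*} {s : Finset ι} {f : ι → E} {c : E} (hc : 0 ≤ c)
    (h : ∀ i ∈ s, f i ⊓ c = 0) : (∑ i ∈ s, f i) ⊓ c = 0 :=
  Finset.sum_induction f (· ⊓ c = 0) (fun _ _ => add_inf_eq_zero) (inf_eq_left.2 hc) h

theorem smul_inf_smul_eq_zero [Module ℝ E] [IsOrderedModule ℝ E] {a b : E} (h : a ⊓ b = 0)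
    {c d : ℝ} (hc : 0 ≤ c) (hd : 0 ≤ d) : c • a ⊓ d • b = 0 := by
  have ha : 0 ≤ a := h.ge.trans inf_le_left
  have hb : 0 ≤ b := h.ge.trans inf_le_right
  have hm : 0 < c + d + 1 := by positivity
  refine le_antisymm ?_ (le_inf (smul_nonneg hc ha) (smul_nonneg hd hb))
  calc c • a ⊓ d • b ≤ (c + d + 1) • a ⊓ (c + d + 1) • b :=
        inf_le_inf (smul_le_smul_of_nonneg_right (by linarith) ha)
          (smul_le_smul_of_nonneg_right (by linarith) hb)
    _ = (c + d + 1) • (a ⊓ b) := ((OrderIso.smulRight hm).map_inf a b).symm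
    _ = 0 := by rw [h, smul_zero]

end Disjoint

section LpDisjoint

variable {α : Type*} [MeasurableSpace α] {μ : Measure α} {p : ℝ≥0∞}

theorem inf_eq_zero_iff_ae {X : Type*} [NormedAddCommGroup X] [Lattice X] [HasSolidNorm X]
    [IsOrderedAddMonoid X] {x y : Lp X p μ} : x ⊓ y = 0 ↔ ∀ᵐ s ∂μ, x s ⊓ y s = 0 := by
  refine Lp.ext_iff.trans (Filter.eventually_congr ?_)
  filter_upwards [Lp.coeFn_inf x y, Lp.coeFn_zero X p μ] with s hinf hzero
  rw [hinf, hzero, Pi.inf_apply, Pi.zero_apply]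

theorem ae_eq_zero_or_eq_zero {x y : Lp ℝ p μ} (h : x ⊓ y = 0) :
    ∀ᵐ t ∂μ, x t = 0 ∨ y t = 0 := by
  filter_upwards [inf_eq_zero_iff_ae.1 h] with t ht
  exact (min_choice (x t) (y t)).imp (fun hx => hx.symm.trans ht) fun hy => hy.symm.trans ht

theorem ae_eq_zero_or_eq_zero_of_pairwise {J : Type*} [Countable J] {x : J → Lp ℝ p μ}
    (h : Pairwise fun i j => x i ⊓ x j = 0) :
    ∀ᵐ t ∂μ, Pairwise fun i j => x i t = 0 ∨ x j t = 0 := by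
  simp only [Pairwise, ae_all_iff, Filter.eventually_imp_distrib_left]
  exact fun i j hij => ae_eq_zero_or_eq_zero (h hij)

theorem norm_eq_of_ae_norm_eq {X Y : Type*} [NormedAddCommGroup X] [NormedAddCommGroup Y]
    {f : Lp X p μ} {g : Lp Y p μ} (h : ∀ᵐ s ∂μ, ‖f s‖ = ‖g s‖) : ‖f‖ = ‖g‖ := by
  rw [Lp.norm_def, Lp.norm_def, eLpNorm_congr_norm_ae h]

end LpDisjoint

section UnitFrame

variable {q : ℝ≥0∞} {J : Type*}

theorem exists_measurable_eq_of_mem {α : Type*} [MeasurableSpace α] [Countable J] [Nonempty J]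
    [MeasurableSpace J] {S : J → Set α} (hS : ∀ j, MeasurableSet (S j))
    (hd : Pairwise fun i j => Disjoint (S i) (S j)) :
    ∃ τ : α → J, Measurable τ ∧ ∀ j, ∀ t ∈ S j, τ t = j := by
  obtain ⟨τ, hτ, hτS⟩ := exists_measurable_piecewise S hS (fun j _ => j)
    (fun _ => measurable_const) fun i j hij t ht => absurd ht.2 ((hd hij).notMem_of_mem_left ht.1)
  exact ⟨τ, hτ, fun j t ht => hτS j ht⟩

/-- Pairwise disjoint positive unit vectors of `L_q` whose supports cover the unit interval. -/
structure IsUnitFrame (x : J → Lp ℝ q lebesgueUnit) : Prop where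
  norm_eq_one : ∀ j, ‖x j‖ = 1
  nonneg : ∀ j, 0 ≤ x j
  disjoint : Pairwise fun i j => x i ⊓ x j = 0
  ae_ne_zero : ∀ᵐ t ∂lebesgueUnit, ∃ j, x j t ≠ 0

namespace IsUnitFrame

theorem ae_exists_pos [Countable J] {x : J → Lp ℝ q lebesgueUnit} (hx : IsUnitFrame x) :
    ∀ᵐ t ∂lebesgueUnit, ∃ j, 0 < x j t ∧ ∀ i ≠ j, x i t = 0 := by
  filter_upwards [hx.ae_ne_zero, ae_all_iff.2 fun j => (Lp.coeFn_nonneg (x j)).2 (hx.nonneg j),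
    ae_eq_zero_or_eq_zero_of_pairwise hx.disjoint] with t ⟨j, hj⟩ hnonneg hdisj
  exact ⟨j, (hnonneg j).lt_of_ne' hj, fun i hij => (hdisj hij).resolve_right hj⟩

theorem exists_measurable_index [Countable J] [Nonempty J] [MeasurableSpace J]
    {x : J → Lp ℝ q lebesgueUnit} (hx : IsUnitFrame x) :
    ∃ τ : ℝ → J, Measurable τ ∧
      ∀ᵐ t ∂lebesgueUnit, 0 < x (τ t) t ∧ ∀ i ≠ τ t, x i t = 0 := by
  have hxm : ∀ j, Measurable (x j) := fun j => (Lp.stronglyMeasurable (x j)).measurable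
  obtain ⟨τ, hτ, hτx⟩ := exists_measurable_eq_of_mem
    (S := fun j => {t | 0 < x j t} ∩ ⋂ (i) (_ : i ≠ j), {t | x i t = 0})
    (fun j => (measurableSet_lt measurable_const (hxm j)).inter <|
      .iInter fun i => .iInter fun _ => measurableSet_eq_fun (hxm i) measurable_const)
    (fun i j hij => disjoint_left.2 fun t hi hj =>
      (show 0 < x i t from hi.1).ne' (mem_iInter₂.1 hj.2 i hij))
  refine ⟨τ, hτ, ?_⟩
  filter_upwards [hx.ae_exists_pos] with t ⟨j, hj, hij⟩
  rw [hτx j t ⟨hj, mem_iInter₂.2 hij⟩]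
  exact ⟨hj, hij⟩

end IsUnitFrame

theorem setLIntegral_enorm_rpow_of_ae_eq_indicator {α X : Type*} [MeasurableSpace α]
    {μ : Measure α} [NormedAddCommGroup X] {p : ℝ≥0∞} (hp0 : p ≠ 0) (hp : p ≠ ∞) {s : Set α}
    (hs : MeasurableSet s) {f : Lp X p μ} {g : α → X} (hfg : f =ᵐ[μ] s.indicator g) :
    ∫⁻ x in s, ‖g x‖ₑ ^ p.toReal ∂μ = ‖f‖ₑ ^ p.toReal := by
  rw [← lintegral_enorm_rpow_Lp hp0 hp, ← lintegral_indicator hs]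
  refine lintegral_congr_ae ?_
  filter_upwards [hfg] with x hx
  by_cases hxs : x ∈ s
  · rw [hx, indicator_of_mem hxs, indicator_of_mem hxs]
  · rw [hx, indicator_of_notMem hxs, indicator_of_notMem hxs, enorm_zero,
      ENNReal.zero_rpow_of_pos (ENNReal.toReal_pos hp0 hp)]

theorem isUnitFrame_normalizedIndicator (hq0 : q ≠ 0) (hq : q ≠ ∞) [MeasurableSpace J]
    [MeasurableSingletonClass J] {θ : ℝ → J} (hθ : Measurable θ) [Countable J]
    (hθ0 : ∀ j, lebesgueUnit (θ ⁻¹' {j}) ≠ 0) :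
    IsUnitFrame fun j =>
      (normalizedIndicator q (hθ (measurableSet_singleton j)) 1 : Lp ℝ q lebesgueUnit) := by
  have hcoe := fun j =>
    coeFn_normalizedIndicator (μ := lebesgueUnit) (p := q) (hθ (measurableSet_singleton j)) (1 : ℝ)
  have hpos : ∀ j, 0 < lebesgueUnit.real (θ ⁻¹' {j}) ^ (1 / q.toReal) := fun j =>
    Real.rpow_pos_of_pos (ENNReal.toReal_pos (hθ0 j) (measure_ne_top _ _)) _
  refine ⟨fun j => ?_, fun j => (Lp.coeFn_nonneg _).1 ?_,
    fun i j hij => inf_eq_zero_iff_ae.2 ?_, ?_⟩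
  · rw [norm_normalizedIndicator hq0 hq _ (hθ0 j), norm_one]
  · filter_upwards [hcoe j] with t ht
    rw [ht]
    exact indicator_nonneg (fun _ _ => by have := hpos j; positivity) t
  · filter_upwards [hcoe i, hcoe j] with t hi hj
    rw [hi, hj]
    by_cases ht : θ t = i
    · rw [indicator_of_mem (show t ∈ θ ⁻¹' {i} from ht),
        indicator_of_notMem (show t ∉ θ ⁻¹' {j} from fun h => hij (ht.symm.trans h))]
      exact inf_eq_right.2 (by have := hpos i; positivity)
    · rw [indicator_of_notMem (show t ∉ θ ⁻¹' {i} from ht)]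
      exact inf_eq_left.2 (indicator_nonneg (fun _ _ => by have := hpos j; positivity) t)
  · filter_upwards [ae_all_iff.2 hcoe] with t ht
    refine ⟨θ t, ?_⟩
    rw [ht, indicator_of_mem (show t ∈ θ ⁻¹' {θ t} from rfl), smul_eq_mul, mul_one]
    exact inv_ne_zero (hpos _).ne'

variable [Fact (1 ≤ q)]

theorem IsUnitFrame.exists_automorphism (hq : q ≠ ∞) [Countable J] [Nonempty J]
    [MeasurableSpace J] [MeasurableSingletonClass J] {θ : ℝ → J} (hθ : Measurable θ)
    (hθ0 : ∀ j, lebesgueUnit (θ ⁻¹' {j}) ≠ 0) {x : J → Lp ℝ q lebesgueUnit} (hx : IsUnitFrame x) :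
    ∃ ψ : Lp ℝ q lebesgueUnit ≃ₗᵢ[ℝ] Lp ℝ q lebesgueUnit, PreservesLattice ψ ∧
      ∀ j, ψ (normalizedIndicator q (hθ (measurableSet_singleton j)) 1) = x j := by
  have hq0 : q ≠ 0 := (zero_lt_one.trans_le (Fact.out : 1 ≤ q)).ne'
  obtain ⟨τ, hτ, hτx⟩ := hx.exists_measurable_index
  have hxτ : ∀ j, x j =ᵐ[lebesgueUnit] (τ ⁻¹' {j}).indicator fun t => x (τ t) t := fun j => by
    filter_upwards [hτx] with t ht
    by_cases hj : τ t = j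
    · rw [indicator_of_mem (show t ∈ τ ⁻¹' {j} from hj), hj]
    · rw [indicator_of_notMem (show t ∉ τ ⁻¹' {j} from hj), ht.2 j (Ne.symm hj)]
  have hxint : ∀ j, ∫⁻ t in τ ⁻¹' {j}, ‖x (τ t) t‖ₑ ^ q.toReal ∂lebesgueUnit = 1 := fun j => by
    rw [setLIntegral_enorm_rpow_of_ae_eq_indicator hq0 hq (hτ (measurableSet_singleton j)) (hxτ j),
      ← ofReal_norm, hx.norm_eq_one, ENNReal.ofReal_one, ENNReal.one_rpow]
  obtain ⟨ψ, hψ, hψx⟩ := exists_automorphism_normalizedIndicator hq hθ hθ0 hτ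
    (measurable_glue hτ fun j => (Lp.stronglyMeasurable (x j)).measurable)
    (hτx.mono fun t ht => ht.1) hxint (.const ℝ (.refl ℝ ℝ)) fun _ =>
      ⟨fun _ _ => rfl, fun _ _ => rfl⟩
  refine ⟨ψ, hψ, fun j => Lp.ext ((hψx j 1).trans ?_)⟩
  simpa using (hxτ j).symm

theorem exists_isUnitFrame_model (J : Type*) [Finite J] [Nonempty J] (hq : q ≠ ∞) :
    ∃ v : J → Lp ℝ q lebesgueUnit, IsUnitFrame v ∧ ∀ x, IsUnitFrame x →
      ∃ ψ : Lp ℝ q lebesgueUnit ≃ₗᵢ[ℝ] Lp ℝ q lebesgueUnit, PreservesLattice ψ ∧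
        ∀ j, ψ (v j) = x j := by
  let _ : MeasurableSpace J := ⊤
  obtain ⟨θ, hθ, hθ0⟩ := exists_measurable_partition J
  exact ⟨_, isUnitFrame_normalizedIndicator (zero_lt_one.trans_le (Fact.out : 1 ≤ q)).ne' hq hθ hθ0,
    fun x hx => hx.exists_automorphism hq hθ hθ0⟩

end UnitFrame

section BlockFrame

variable {q : ℝ≥0∞} {ι K : Type*}

/-- The vectors `x i` in the block `κ i = k` are positive, pairwise disjoint and of norm `c`; the
other `x i` vanish. -/
structure IsBlockFrame (κ : ι → K) (k : K) (c : ℝ) (x : ι → Lp ℝ q lebesgueUnit) : Prop where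
  eq_zero : ∀ i, κ i ≠ k → x i = 0
  norm_eq : ∀ i, κ i = k → ‖x i‖ = c
  nonneg : ∀ i, 0 ≤ x i
  disjoint : Pairwise fun i j => x i ⊓ x j = 0

/-- A nonzero block frame whose supports cover the unit interval. -/
structure IsFullBlockFrame (κ : ι → K) (k : K) (c : ℝ) (x : ι → Lp ℝ q lebesgueUnit) : Prop
    extends IsBlockFrame κ k c x where
  pos : 0 < c
  ae_ne_zero : ∀ᵐ t ∂lebesgueUnit, ∃ i, x i t ≠ 0

variable {κ : ι → K} {k : K} {c : ℝ} {x : ι → Lp ℝ q lebesgueUnit}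

theorem IsBlockFrame.norm_eq_norm (h : IsBlockFrame κ k c x) {i j : ι} (hij : κ i = κ j) :
    ‖x i‖ = ‖x j‖ := by
  by_cases hi : κ i = k
  · rw [h.norm_eq i hi, h.norm_eq j (hij ▸ hi)]
  · rw [h.eq_zero i hi, h.eq_zero j (hij ▸ hi)]

theorem IsUnitFrame.isFullBlockFrame [DecidableEq K] {v : {i // κ i = k} → Lp ℝ q lebesgueUnit}
    (hv : IsUnitFrame v) :
    IsFullBlockFrame κ k 1 fun i => if h : κ i = k then v ⟨i, h⟩ else 0 where
  eq_zero i hi := dif_neg hi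
  norm_eq i hi := by rw [dif_pos hi, hv.norm_eq_one]
  nonneg i := by
    by_cases hi : κ i = k
    · rw [dif_pos hi]
      exact hv.nonneg _
    · rw [dif_neg hi]
  disjoint i j hij := by
    by_cases hi : κ i = k <;> by_cases hj : κ j = k
    · simp only [dif_pos hi, dif_pos hj]
      exact hv.disjoint (by simpa using hij)
    · simp only [dif_pos hi, dif_neg hj, inf_eq_right, hv.nonneg]
    · simp only [dif_neg hi, dif_pos hj, inf_eq_left, hv.nonneg]
    · simp only [dif_neg hi, dif_neg hj, inf_idem]
  pos := one_pos
  ae_ne_zero := hv.ae_ne_zero.mono fun t ⟨i, hi⟩ => ⟨i, by rwa [dif_pos i.2]⟩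

variable [Fact (1 ≤ q)]

theorem IsFullBlockFrame.smul [Countable ι] (h : IsFullBlockFrame κ k c x) {δ : ℝ} (hδ : 0 < δ) :
    IsFullBlockFrame κ k (δ * c) (δ • x) where
  eq_zero i hi := by rw [Pi.smul_apply, h.eq_zero i hi, smul_zero]
  norm_eq i hi := by rw [Pi.smul_apply, norm_smul, h.norm_eq i hi, Real.norm_of_nonneg hδ.le]
  nonneg i := smul_nonneg hδ.le (h.nonneg i)
  disjoint _ _ hij := smul_inf_smul_eq_zero (h.disjoint hij) hδ.le hδ.le
  pos := mul_pos hδ h.pos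
  ae_ne_zero := by
    filter_upwards [h.ae_ne_zero, ae_all_iff.2 fun i => Lp.coeFn_smul δ (x i)] with t ⟨i, hi⟩ hsmul
    exact ⟨i, by simpa [hsmul] using ⟨hδ.ne', hi⟩⟩

theorem IsFullBlockFrame.isUnitFrame [Countable ι] (h : IsFullBlockFrame κ k c x) :
    IsUnitFrame fun i : {i // κ i = k} => c⁻¹ • x i where
  norm_eq_one i := by
    rw [norm_smul, h.norm_eq i i.2, norm_inv, Real.norm_of_nonneg h.pos.le,
      inv_mul_cancel₀ h.pos.ne']
  nonneg i := smul_nonneg (inv_nonneg.2 h.pos.le) (h.nonneg i)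
  disjoint i j hij := by
    have hc : 0 ≤ c⁻¹ := inv_nonneg.2 h.pos.le
    exact smul_inf_smul_eq_zero (h.disjoint (Subtype.coe_injective.ne hij)) hc hc
  ae_ne_zero := by
    have hz : ∀ᵐ t ∂lebesgueUnit, ∀ i, κ i ≠ k → x i t = 0 := by
      simp only [ae_all_iff, Filter.eventually_imp_distrib_left]
      intro i hi
      rw [h.eq_zero i hi]
      exact Lp.coeFn_zero ℝ q lebesgueUnit
    filter_upwards [h.ae_ne_zero, hz, ae_all_iff.2 fun i => Lp.coeFn_smul c⁻¹ (x i)]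
      with t ⟨i, hi⟩ hz hsmul
    exact ⟨⟨i, not_imp_comm.1 (hz i) hi⟩, by simpa [hsmul] using ⟨h.pos.ne', hi⟩⟩

theorem exists_isFullBlockFrame_model [Finite ι] (hq : q ≠ ∞) (hk : ∃ i, κ i = k) :
    ∃ v : ι → Lp ℝ q lebesgueUnit, IsFullBlockFrame κ k 1 v ∧
      ∀ c x, IsFullBlockFrame κ k c x →
        ∃ ψ : Lp ℝ q lebesgueUnit ≃ₗᵢ[ℝ] Lp ℝ q lebesgueUnit, PreservesLattice ψ ∧
          ∀ i, ψ (v i) = c⁻¹ • x i := by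
  classical
  have : Nonempty {i // κ i = k} := nonempty_subtype.2 hk
  obtain ⟨v, hv, hvψ⟩ := exists_isUnitFrame_model {i // κ i = k} hq
  refine ⟨fun i => if h : κ i = k then v ⟨i, h⟩ else 0, hv.isFullBlockFrame, fun c x hx => ?_⟩
  obtain ⟨ψ, hψ, hψv⟩ := hvψ _ hx.isUnitFrame
  refine ⟨ψ, hψ, fun i => ?_⟩
  by_cases hi : κ i = k
  · simp only [dif_pos hi, hψv]
  · simp only [dif_neg hi, map_zero, hx.eq_zero i hi, smul_zero]

end BlockFrame

section BaseModel

theorem exists_simpleFunc_of_forall_exists {α β γ : Type*} [MeasurableSpace α] [Nonempty γ]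
    {P : β → γ → Prop} (f : SimpleFunc α β) (h : ∀ a, ∃ c, P (f a) c) :
    ∃ g : SimpleFunc α γ, ∀ a, P (f a) (g a) := by
  have hrange : ∀ b ∈ range f, ∃ c, P b c := forall_mem_range.2 h
  choose! g hg using hrange
  exact ⟨f.map g, fun a => hg _ (mem_range_self a)⟩

variable {p q : ℝ≥0∞} {ι K : Type*} {κ : ι → K}

theorem ae_eq_indicator_of_isBlockFrame {X : ℝ → ι → Lp ℝ q lebesgueUnit} {τ : ℝ → K} {c : ℝ → ℝ}
    (hX : ∀ s, IsBlockFrame κ (τ s) (c s) (X s)) {i : ι} {f : ℝ → Lp ℝ q lebesgueUnit}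
    (hf : f =ᵐ[lebesgueUnit] fun s => X s i) :
    f =ᵐ[lebesgueUnit] (τ ⁻¹' {κ i}).indicator fun s => X s i := by
  filter_upwards [hf] with s hs
  by_cases hi : τ s = κ i
  · rw [hs, indicator_of_mem (show s ∈ τ ⁻¹' {κ i} from hi)]
  · rw [hs, indicator_of_notMem (show s ∉ τ ⁻¹' {κ i} from hi), (hX s).eq_zero i (Ne.symm hi)]

variable [Fact (1 ≤ p)] [Fact (1 ≤ q)]

theorem setLIntegral_enorm_div_norm_rpow (hp : p ≠ ∞) {X : ℝ → ι → Lp ℝ q lebesgueUnit}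
    {τ : SimpleFunc ℝ K} {c : ℝ → ℝ} (hX : ∀ s, IsFullBlockFrame κ (τ s) (c s) (X s)) {i : ι}
    {f : LpLq p q} (hf : f =ᵐ[lebesgueUnit] fun s => X s i) (hf0 : f ≠ 0) :
    ∫⁻ s in τ ⁻¹' {κ i}, ‖c s / ‖f‖‖ₑ ^ p.toReal ∂lebesgueUnit = 1 := by
  have hp0 : p ≠ 0 := (zero_lt_one.trans_le (Fact.out : 1 ≤ p)).ne'
  have hτi : MeasurableSet (τ ⁻¹' {κ i}) := τ.measurableSet_preimage _
  have hrep : (‖f‖⁻¹ • f : LpLq p q) =ᵐ[lebesgueUnit]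
      (τ ⁻¹' {κ i}).indicator fun s => ‖f‖⁻¹ • X s i := by
    filter_upwards [Lp.coeFn_smul ‖f‖⁻¹ f,
      ae_eq_indicator_of_isBlockFrame (fun s => (hX s).toIsBlockFrame) hf] with s hsmul hs
    rw [hsmul, Pi.smul_apply, hs, indicator_const_smul_apply]
  have hnorm : ∀ s ∈ τ ⁻¹' {κ i}, ‖c s / ‖f‖‖ₑ = ‖‖f‖⁻¹ • X s i‖ₑ := fun s hs => by
    rw [← ofReal_norm, ← ofReal_norm, norm_smul, (hX s).norm_eq i (Eq.symm hs), norm_div, norm_inv,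
      Real.norm_of_nonneg (hX s).pos.le, div_eq_inv_mul]
  rw [setLIntegral_congr_fun hτi fun s hs => congrArg (· ^ p.toReal) (hnorm s hs),
    setLIntegral_enorm_rpow_of_ae_eq_indicator hp0 hp hτi hrep, ← ofReal_norm, norm_smul, norm_inv,
    norm_norm, inv_mul_cancel₀ (norm_ne_zero_iff.2 hf0), ENNReal.ofReal_one, ENNReal.one_rpow]

theorem exists_automorphism_of_isFullBlockFrame (hp : p ≠ ∞) (hκ : Function.Surjective κ)
    [Countable K] [MeasurableSpace K] [MeasurableSingletonClass K] {θ : ℝ → K} (hθ : Measurable θ)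
    (hθ0 : ∀ k, lebesgueUnit (θ ⁻¹' {k}) ≠ 0) {v : K → ι → Lp ℝ q lebesgueUnit}
    {X : ℝ → ι → Lp ℝ q lebesgueUnit} {τ : SimpleFunc ℝ K} {c : SimpleFunc ℝ ℝ}
    (hX : ∀ s, IsFullBlockFrame κ (τ s) (c s) (X s))
    {ψ : SimpleFunc ℝ (Lp ℝ q lebesgueUnit ≃ₗᵢ[ℝ] Lp ℝ q lebesgueUnit)}
    (hψ : ∀ s, PreservesLattice (ψ s)) (hψv : ∀ s i, ψ s (v (τ s) i) = (c s)⁻¹ • X s i)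
    {x : ι → LpLq p q} (hx : ∀ i, x i =ᵐ[lebesgueUnit] fun s => X s i) (hx0 : ∀ i, x i ≠ 0) :
    ∃ φ : LpLq p q ≃ₗᵢ[ℝ] LpLq p q, PreservesLattice φ ∧ ∀ i,
      φ (normalizedIndicator p (hθ (measurableSet_singleton (κ i))) (v (κ i) i)) =
        ‖x i‖⁻¹ • x i := by
  have hnorm : ∀ i j, κ i = κ j → ‖x i‖ = ‖x j‖ := fun i j hij => norm_eq_of_ae_norm_eq <| by
    filter_upwards [hx i, hx j] with s hi hj
    rw [hi, hj, (hX s).norm_eq_norm hij]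
  let D : K → ℝ := fun k => ‖x (Function.surjInv hκ k)‖
  have hD : ∀ i, D (κ i) = ‖x i‖ := fun i => hnorm _ _ (Function.surjInv_eq hκ _)
  have hmass : ∀ k, ∫⁻ s in τ ⁻¹' {k}, ‖c s / D (τ s)‖ₑ ^ p.toReal ∂lebesgueUnit = 1 :=
    hκ.forall.2 fun i => by
      rw [← setLIntegral_enorm_div_norm_rpow hp hX (hx i) (hx0 i)]
      refine setLIntegral_congr_fun (τ.measurableSet_preimage _) fun s hs => ?_
      simp only [show τ s = κ i from hs, hD]
  obtain ⟨φ, hφ, hφu⟩ := exists_automorphism_normalizedIndicator hp hθ hθ0 τ.measurable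
    (W := fun s => c s / D (τ s))
    (c.measurable.div ((measurable_of_countable D).comp τ.measurable))
    (.of_forall fun s => div_pos (hX s).pos (norm_pos_iff.2 (hx0 _))) hmass ψ hψ
  refine ⟨φ, hφ, fun i => Lp.ext ?_⟩
  filter_upwards [hφu (κ i) (v (κ i) i), Lp.coeFn_smul ‖x i‖⁻¹ (x i),
    ae_eq_indicator_of_isBlockFrame (fun s => (hX s).toIsBlockFrame) (hx i)] with s hs hsmul hxs
  rw [hs, hsmul, Pi.smul_apply, hxs]
  by_cases hi : τ s = κ i
  · have hψi : ψ s (v (κ i) i) = (c s)⁻¹ • X s i := hi ▸ hψv s i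
    rw [indicator_of_mem (show s ∈ τ ⁻¹' {κ i} from hi),
      indicator_of_mem (show s ∈ τ ⁻¹' {κ i} from hi), hψi, hi, hD, smul_smul, div_eq_inv_mul,
      mul_inv_cancel_right₀ (hX s).pos.ne']
  · rw [indicator_of_notMem (show s ∉ τ ⁻¹' {κ i} from hi),
      indicator_of_notMem (show s ∉ τ ⁻¹' {κ i} from hi), smul_zero]

theorem exists_base_model (hp : p ≠ ∞) (hq : q ≠ ∞) [Finite ι] [Nonempty ι]
    (hκ : Function.Surjective κ) :
    ∃ u : ι → LpLq p q, ∀ (X : SimpleFunc ℝ (ι → Lp ℝ q lebesgueUnit)) (x : ι → LpLq p q),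
      (∀ s, ∃ k c, IsFullBlockFrame κ k c (X s)) → (∀ i, x i =ᵐ[lebesgueUnit] fun s => X s i) →
      (∀ i, x i ≠ 0) →
      ∃ φ : LpLq p q ≃ₗᵢ[ℝ] LpLq p q, PreservesLattice φ ∧ ∀ i, φ (u i) = ‖x i‖⁻¹ • x i := by
  have : Finite K := .of_surjective κ hκ
  have : Nonempty K := .map κ ‹_›
  let _ : MeasurableSpace K := ⊤
  obtain ⟨θ, hθ, hθ0⟩ := exists_measurable_partition K
  choose v _ hv using fun k => exists_isFullBlockFrame_model hq (hκ k)
  refine ⟨fun i => normalizedIndicator p (hθ (measurableSet_singleton (κ i))) (v (κ i) i),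
    fun X x hX hx hx0 => ?_⟩
  obtain ⟨d, hd⟩ := exists_simpleFunc_of_forall_exists X
    (P := fun y (d : K × ℝ × (Lp ℝ q lebesgueUnit ≃ₗᵢ[ℝ] Lp ℝ q lebesgueUnit)) =>
      IsFullBlockFrame κ d.1 d.2.1 y ∧ PreservesLattice d.2.2 ∧
        ∀ i, d.2.2 (v d.1 i) = d.2.1⁻¹ • y i) fun s => by
    obtain ⟨k, c, hc⟩ := hX s
    obtain ⟨ψ, hψ⟩ := hv k c (X s) hc
    exact ⟨(k, c, ψ), hc, hψ⟩
  exact exists_automorphism_of_isFullBlockFrame hp hκ hθ hθ0 (X := X) (τ := d.map Prod.fst)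
    (c := d.map (Prod.fst ∘ Prod.snd)) (ψ := d.map (Prod.snd ∘ Prod.snd))
    (fun s => (hd s).1) (fun s => (hd s).2.1) (fun s => (hd s).2.2) hx hx0

end BaseModel

open scoped Topology

section Approximation

theorem tendsto_norm_div_smul_add {E : Type*} [NormedAddCommGroup E] [NormedSpace ℝ E] {x : E}
    (hx : x ≠ 0) (z : E) :
    Filter.Tendsto (fun δ : ℝ => (‖x‖ / ‖x + δ • z‖) • (x + δ • z)) (𝓝 0) (𝓝 x) := by
  have hadd : Filter.Tendsto (fun δ : ℝ => x + δ • z) (𝓝 0) (𝓝 x) := by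
    simpa using ((Filter.tendsto_id (x := 𝓝 (0 : ℝ))).smul_const z).const_add x
  simpa [hx] using ((tendsto_const_nhds (x := ‖x‖)).div hadd.norm (norm_ne_zero_iff.2 hx)).smul hadd

theorem exists_disjoint_ae_ne_zero {α ι : Type*} [MeasurableSpace α] {μ : Measure α}
    [IsFiniteMeasure μ] [Countable ι] {p : ℝ≥0∞} {x : ι → Lp ℝ p μ} (hx : ∀ i, 0 ≤ x i) :
    ∃ z : Lp ℝ p μ, 0 ≤ z ∧ (∀ i, x i ⊓ z = 0) ∧ ∀ᵐ t ∂μ, z t ≠ 0 ∨ ∃ i, x i t ≠ 0 := by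
  have hZ : MeasurableSet (⋂ i, {t | x i t = 0}) := .iInter fun i =>
    measurableSet_eq_fun (Lp.stronglyMeasurable (x i)).measurable measurable_const
  obtain ⟨z, hz⟩ : ∃ z : Lp ℝ p μ, z =ᵐ[μ] (⋂ i, {t | x i t = 0}).indicator fun _ => 1 :=
    ⟨_, indicatorConstLp_coeFn (hs := hZ) (hμs := measure_ne_top μ _)⟩
  refine ⟨z, (Lp.coeFn_nonneg _).1 ?_, fun i => inf_eq_zero_iff_ae.2 ?_, ?_⟩
  · filter_upwards [hz] with t ht
    rw [ht]
    exact indicator_nonneg (fun _ _ => zero_le_one) t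
  · filter_upwards [hz, (Lp.coeFn_nonneg (x i)).2 (hx i)] with t ht hxt
    rw [ht]
    by_cases htZ : t ∈ ⋂ i, {t | x i t = 0}
    · rw [show x i t = 0 from mem_iInter.1 htZ i]
      exact inf_eq_left.2 (indicator_nonneg (fun _ _ => zero_le_one) t)
    · rw [indicator_of_notMem htZ]
      exact inf_eq_right.2 hxt
  · filter_upwards [hz] with t ht
    by_cases htZ : t ∈ ⋂ i, {t | x i t = 0}
    · exact .inl (by rw [ht, indicator_of_mem htZ]; exact one_ne_zero)
    · exact .inr (by simpa using htZ)

variable {q : ℝ≥0∞} [Fact (1 ≤ q)] {ι K : Type*} {κ : ι → K} {k : K} {c : ℝ}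
  {x : ι → Lp ℝ q lebesgueUnit}

namespace IsBlockFrame

theorem isFullBlockFrame_update [DecidableEq ι] (h : IsBlockFrame κ k c x) (hc : 0 < c) {i₀ : ι}
    (hi₀ : κ i₀ = k) {z : Lp ℝ q lebesgueUnit} (hz : 0 ≤ z) (hxz : ∀ i, x i ⊓ z = 0)
    (hcover : ∀ᵐ t ∂lebesgueUnit, z t ≠ 0 ∨ ∃ i, x i t ≠ 0) :
    IsFullBlockFrame κ k c
      (Function.update x i₀ ((‖x i₀‖ / ‖x i₀ + z‖) • (x i₀ + z))) := by
  have hx0 : x i₀ ≠ 0 := norm_pos_iff.1 (by rwa [h.norm_eq i₀ hi₀])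
  have hxz0 : 0 < ‖x i₀ + z‖ := norm_pos_iff.2 fun h0 =>
    hx0 ((add_eq_zero_iff_of_nonneg (h.nonneg i₀) hz).1 h0).1
  have ha : 0 < ‖x i₀‖ / ‖x i₀ + z‖ := div_pos (norm_pos_iff.2 hx0) hxz0
  have hdisj : ∀ j ≠ i₀, (‖x i₀‖ / ‖x i₀ + z‖) • (x i₀ + z) ⊓ x j = 0 := fun j hj => by
    simpa using smul_inf_smul_eq_zero (add_inf_eq_zero (h.disjoint hj.symm)
      ((inf_comm _ _).trans (hxz j))) ha.le zero_le_one
  refine ⟨⟨fun i hi => ?_, fun i hi => ?_, fun i => ?_, fun i j hij => ?_⟩, hc, ?_⟩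
  · rw [Function.update_of_ne (by rintro rfl; exact hi hi₀), h.eq_zero i hi]
  · rcases eq_or_ne i i₀ with rfl | hne
    · rw [Function.update_self, norm_smul, Real.norm_of_nonneg ha.le, div_mul_cancel₀ _ hxz0.ne',
        h.norm_eq i hi]
    · rw [Function.update_of_ne hne, h.norm_eq i hi]
  · rcases eq_or_ne i i₀ with rfl | hne
    · rw [Function.update_self]
      exact smul_nonneg ha.le (add_nonneg (h.nonneg i) hz)
    · rw [Function.update_of_ne hne]
      exact h.nonneg i
  · rcases eq_or_ne i i₀ with rfl | hi
    · simpa [hij.symm] using hdisj j hij.symm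
    rcases eq_or_ne j i₀ with rfl | hj
    · simpa [hij, inf_comm] using hdisj i hij
    · simpa [hi, hj] using h.disjoint hij
  · filter_upwards [hcover, Lp.coeFn_smul (‖x i₀‖ / ‖x i₀ + z‖) (x i₀ + z),
      Lp.coeFn_add (x i₀) z, (Lp.coeFn_nonneg (x i₀)).2 (h.nonneg i₀),
      (Lp.coeFn_nonneg z).2 hz] with t ht hsmul hadd hxt hzt
    have hne : x i₀ t ≠ 0 ∨ z t ≠ 0 → ((‖x i₀‖ / ‖x i₀ + z‖) • (x i₀ + z)) t ≠ 0 := fun hor => by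
      rw [hsmul, Pi.smul_apply, hadd]
      refine smul_ne_zero ha.ne' fun hsum => ?_
      have hzero := (add_eq_zero_iff_of_nonneg hxt hzt).1 hsum
      exact hor.elim (absurd hzero.1) (absurd hzero.2)
    rcases ht with ht | ⟨i, hi⟩
    · exact ⟨i₀, by simpa using hne (.inr ht)⟩
    rcases eq_or_ne i i₀ with rfl | hi₀
    · exact ⟨i, by simpa using hne (.inl hi)⟩
    · exact ⟨i, by rwa [Function.update_of_ne hi₀]⟩

theorem mem_closure_of_pos [Countable ι] (h : IsBlockFrame κ k c x) (hc : 0 < c)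
    (hk : ∃ i, κ i = k) : x ∈ closure {y | IsFullBlockFrame κ k c y} := by
  classical
  obtain ⟨i₀, hi₀⟩ := hk
  obtain ⟨z, hz, hxz, hcover⟩ := exists_disjoint_ae_ne_zero h.nonneg
  have hx0 : x i₀ ≠ 0 := norm_pos_iff.1 (by rwa [h.norm_eq i₀ hi₀])
  have hlim := (tendsto_const_nhds (x := x)).update i₀ (tendsto_norm_div_smul_add hx0 z)
  rw [Function.update_eq_self] at hlim
  refine mem_closure_of_tendsto (hlim.mono_left (nhdsWithin_le_nhds (s := Ioi 0))) ?_
  filter_upwards [self_mem_nhdsWithin] with δ (hδ : 0 < δ)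
  refine h.isFullBlockFrame_update hc hi₀ (smul_nonneg hδ.le hz) (fun i => ?_) ?_
  · simpa using smul_inf_smul_eq_zero (hxz i) zero_le_one hδ.le
  · filter_upwards [hcover, Lp.coeFn_smul δ z] with t ht hsmul
    refine ht.imp_left fun hzt => ?_
    rw [hsmul]
    exact smul_ne_zero hδ.ne' hzt

theorem mem_closure [Finite ι] (hq : q ≠ ∞) (h : IsBlockFrame κ k c x) (hk : ∃ i, κ i = k) :
    x ∈ closure {y | ∃ k c, IsFullBlockFrame κ k c y} := by
  rcases lt_or_ge 0 c with hc | hc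
  · exact closure_mono (fun _ hy => Exists.intro k (Exists.intro c hy)) (h.mem_closure_of_pos hc hk)
  have hx : x = 0 := by
    funext i
    by_cases hi : κ i = k
    · exact norm_le_zero_iff.1 ((h.norm_eq i hi).trans_le hc)
    · exact h.eq_zero i hi
  obtain ⟨v, hv, -⟩ := exists_isFullBlockFrame_model hq hk
  have hlim : Filter.Tendsto (fun δ : ℝ => δ • v) (𝓝[>] 0) (𝓝 x) := by
    simpa [hx] using ((Filter.tendsto_id (x := 𝓝 (0 : ℝ))).smul_const v).mono_left
      nhdsWithin_le_nhds
  refine mem_closure_of_tendsto hlim ?_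
  filter_upwards [self_mem_nhdsWithin] with δ (hδ : 0 < δ)
  exact ⟨k, δ * 1, hv.smul hδ⟩

end IsBlockFrame

theorem exists_simpleFunc_norm_sub_lt {α ι X : Type*} [MeasurableSpace α] {μ : Measure α}
    [IsFiniteMeasure μ] [Finite ι] [NormedAddCommGroup X] [SecondCountableTopology X] {p : ℝ≥0∞}
    [Fact (1 ≤ p)] (hp : p ≠ ∞) {S : Set (ι → X)} (hS : S.Nonempty) {x : ι → Lp X p μ}
    (hx : ∀ᵐ s ∂μ, (fun i => x i s) ∈ closure S) {ε : ℝ} (hε : 0 < ε) :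
    ∃ (F : SimpleFunc α (ι → X)) (x' : ι → Lp X p μ), (∀ s, F s ∈ S) ∧
      (∀ i, x' i =ᵐ[μ] fun s => F s i) ∧ ∀ i, ‖x' i - x i‖ < ε := by
  cases nonempty_fintype ι
  borelize X
  obtain ⟨y₀, hy₀⟩ := hS
  let f : α → ι → X := fun s i => x i s
  have hf : Measurable f := measurable_pi_iff.2 fun i => (Lp.stronglyMeasurable (x i)).measurable
  have hfp : MemLp f p μ := memLp_pi_iff.2 fun i => Lp.memLp (x i)
  have hlim := SimpleFunc.tendsto_approxOn_Lp_eLpNorm hf hy₀ hp hx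
    (hfp.sub (memLp_const y₀)).eLpNorm_lt_top
  obtain ⟨n, hn⟩ := (hlim.eventually (gt_mem_nhds (ENNReal.ofReal_pos.2 hε))).exists
  set F := SimpleFunc.approxOn f hf S y₀ hy₀ n
  have hF : ∀ i, MemLp (fun s => F s i) p μ :=
    memLp_pi_iff.1 (SimpleFunc.memLp_of_isFiniteMeasure F p μ)
  refine ⟨F, fun i => (hF i).toLp, fun s => SimpleFunc.approxOn_mem hf hy₀ n s,
    fun i => (hF i).coeFn_toLp, fun i => ?_⟩
  rw [← ENNReal.ofReal_lt_ofReal_iff hε, ofReal_norm, Lp.enorm_def]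
  refine lt_of_le_of_lt (eLpNorm_mono_ae ?_) hn
  filter_upwards [Lp.coeFn_sub (hF i).toLp (x i), (hF i).coeFn_toLp] with s hsub hFs
  rw [hsub, Pi.sub_apply, hFs]
  exact norm_le_pi_norm (F s - f s) i

end Approximation

section CanonicalForm

theorem norm_inv_norm_smul_sub_self {E : Type*} [NormedAddCommGroup E] [NormedSpace ℝ E] {x : E}
    (hx : x ≠ 0) : ‖‖x‖⁻¹ • x - x‖ = |1 - ‖x‖| := by
  have hx' : 0 < ‖x‖ := norm_pos_iff.2 hx
  calc ‖‖x‖⁻¹ • x - x‖ = ‖(‖x‖⁻¹ - 1) • x‖ := by rw [sub_smul, one_smul]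
    _ = |‖x‖⁻¹ - 1| * ‖x‖ := by rw [norm_smul, Real.norm_eq_abs]
    _ = |1 - ‖x‖| := by
      rw [← abs_of_pos hx', ← abs_mul, abs_of_pos hx', sub_one_mul, inv_mul_cancel₀ hx'.ne']

theorem PreservesLattice.symm {X Y : Type*} [SeminormedAddCommGroup X] [NormedSpace ℝ X] [Lattice X]
    [SeminormedAddCommGroup Y] [NormedSpace ℝ Y] [Lattice Y] {φ : X ≃ₗᵢ[ℝ] Y}
    (hφ : PreservesLattice φ) : PreservesLattice φ.symm :=
  ⟨fun f g => φ.injective (by simp [hφ.1]), fun f g => φ.injective (by simp [hφ.2])⟩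

theorem PreservesLattice.comp {X Y Z : Type*} [Lattice X] [Lattice Y] [Lattice Z] {g : Y → Z}
    {f : X → Y} (hg : PreservesLattice g) (hf : PreservesLattice f) : PreservesLattice (g ∘ f) :=
  ⟨fun x y => by simp [hf.1, hg.1], fun x y => by simp [hf.2, hg.2]⟩

variable {p q : ℝ≥0∞} [Fact (1 ≤ p)] [Fact (1 ≤ q)] {ι K : Type*} {κ : ι → K}

theorem exists_approximate_base_model (hp : p ≠ ∞) (hq : q ≠ ∞) [Finite ι] [Nonempty ι]
    (hκ : Function.Surjective κ) :
    ∃ u : ι → LpLq p q, ∀ x : ι → LpLq p q, (∀ i, ‖x i‖ = 1) →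
      (∀ᵐ s ∂lebesgueUnit, ∃ k c, IsBlockFrame κ k c fun i => x i s) → ∀ ε > 0,
      ∃ φ : LpLq p q ≃ₗᵢ[ℝ] LpLq p q, PreservesLattice φ ∧ ∀ i, ‖φ (u i) - x i‖ < ε := by
  have : Fact (q ≠ ∞) := ⟨hq⟩
  obtain ⟨v, hv, -⟩ := exists_isFullBlockFrame_model hq (hκ (κ (Classical.arbitrary ι)))
  have hne : ({y | ∃ k c, IsFullBlockFrame κ k c y} : Set (ι → Lp ℝ q lebesgueUnit)).Nonempty :=
    ⟨v, _, 1, hv⟩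
  obtain ⟨u, hu⟩ := exists_base_model (p := p) hp hq hκ
  refine ⟨u, fun x hx1 hx ε hε => ?_⟩
  have hcl : ∀ᵐ s ∂lebesgueUnit,
      (fun i => x i s) ∈ closure {y | ∃ k c, IsFullBlockFrame κ k c y} :=
    hx.mono fun s ⟨k, c, h⟩ => h.mem_closure hq (hκ k)
  obtain ⟨X, x', hX, hx', hxx'⟩ := exists_simpleFunc_norm_sub_lt (p := p) hp hne
    hcl (lt_min (half_pos hε) one_pos)
  have hx'0 : ∀ i, x' i ≠ 0 := fun i h0 => by
    simpa [h0, hx1 i] using (hxx' i).trans_le (min_le_right _ _)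
  obtain ⟨φ, hφ, hφu⟩ := hu X x' hX hx' hx'0
  refine ⟨φ, hφ, fun i => ?_⟩
  calc ‖φ (u i) - x i‖ ≤ ‖φ (u i) - x' i‖ + ‖x' i - x i‖ := norm_sub_le_norm_sub_add_norm_sub ..
    _ = |‖x i‖ - ‖x' i‖| + ‖x' i - x i‖ := by
      rw [hφu, norm_inv_norm_smul_sub_self (hx'0 i), hx1]
    _ ≤ ‖x' i - x i‖ + ‖x' i - x i‖ := by
      grw [abs_norm_sub_norm_le, norm_sub_rev]
    _ < ε := by linarith [(hxx' i).trans_le (min_le_left (ε / 2) 1)]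

theorem exists_automorphism_of_isBlockFrame (hp : p ≠ ∞) (hq : q ≠ ∞) [Finite ι] [Nonempty ι]
    (hκ : Function.Surjective κ) {x y : ι → LpLq p q} (hx1 : ∀ i, ‖x i‖ = 1)
    (hy1 : ∀ i, ‖y i‖ = 1) (hx : ∀ᵐ s ∂lebesgueUnit, ∃ k c, IsBlockFrame κ k c fun i => x i s)
    (hy : ∀ᵐ s ∂lebesgueUnit, ∃ k c, IsBlockFrame κ k c fun i => y i s) {ε : ℝ} (hε : 0 < ε) :
    ∃ φ : LpLq p q ≃ₗᵢ[ℝ] LpLq p q, PreservesLattice φ ∧ ∀ i, ‖φ (x i) - y i‖ < ε := by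
  obtain ⟨u, hu⟩ := exists_approximate_base_model (p := p) hp hq hκ
  obtain ⟨φ, hφ, hφx⟩ := hu x hx1 hx (ε / 2) (half_pos hε)
  obtain ⟨χ, hχ, hχy⟩ := hu y hy1 hy (ε / 2) (half_pos hε)
  refine ⟨φ.symm.trans χ, hχ.comp hφ.symm, fun i => ?_⟩
  calc ‖χ (φ.symm (x i)) - y i‖
      ≤ ‖χ (φ.symm (x i)) - χ (u i)‖ + ‖χ (u i) - y i‖ := norm_sub_le_norm_sub_add_norm_sub ..
    _ = ‖φ (u i) - x i‖ + ‖χ (u i) - y i‖ := by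
      rw [← map_sub, LinearIsometryEquiv.norm_map, ← φ.norm_map, map_sub, φ.apply_symm_apply,
        norm_sub_rev]
    _ < ε := by linarith [hφx i, hχy i]

end CanonicalForm

section RpowComparison

variable {a b r : ℝ}

theorem rpow_add_rpow_lt_add_rpow (ha : 0 < a) (hb : 0 < b) (hr : 1 < r) :
    a ^ r + b ^ r < (a + b) ^ r := by
  have hpow : ∀ c : ℝ, 0 < c → c ^ r = c * c ^ (r - 1) := fun c hc => by
    rw [mul_comm, ← Real.rpow_add_one hc.ne', sub_add_cancel]
  rw [hpow a ha, hpow b hb, hpow _ (add_pos ha hb), add_mul]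
  gcongr <;> linarith

theorem add_rpow_lt_rpow_add_rpow (ha : 0 < a) (hb : 0 < b) (hr : r < 1) :
    (a + b) ^ r < a ^ r + b ^ r := by
  have hpow : ∀ c : ℝ, 0 < c → c ^ r = c * c ^ (r - 1) := fun c hc => by
    rw [mul_comm, ← Real.rpow_add_one hc.ne', sub_add_cancel]
  have hr' := sub_neg.2 hr
  rw [hpow a ha, hpow b hb, hpow _ (add_pos ha hb), add_mul]
  gcongr ?_ * ?_ + ?_ * ?_
  · exact Real.rpow_lt_rpow_of_neg ha (by linarith) hr'
  · exact Real.rpow_lt_rpow_of_neg hb (by linarith) hr'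

theorem add_rpow_eq_two_rpow_mul (ha : 0 ≤ a) (hb : 0 ≤ b) :
    (a + b) ^ r = 2 ^ r * ((1 / 2 : ℝ) • a + (1 / 2 : ℝ) • b) ^ r := by
  simp only [smul_eq_mul]
  rw [← Real.mul_rpow zero_le_two (by positivity)]
  ring_nf

theorem add_rpow_lt_two_rpow_mul (ha : 0 ≤ a) (hb : 0 ≤ b) (hab : a ≠ b) (hr : 1 < r) :
    (a + b) ^ r < 2 ^ r * ((a ^ r + b ^ r) / 2) := by
  have hmid := (strictConvexOn_rpow hr).2 ha hb hab one_half_pos one_half_pos (add_halves 1)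
  rw [add_rpow_eq_two_rpow_mul ha hb]
  gcongr
  exact hmid.trans_eq (by rw [smul_eq_mul, smul_eq_mul]; ring)

theorem two_rpow_mul_lt_add_rpow (ha : 0 ≤ a) (hb : 0 ≤ b) (hab : a ≠ b) (hr0 : 0 < r)
    (hr : r < 1) : 2 ^ r * ((a ^ r + b ^ r) / 2) < (a + b) ^ r := by
  have hmid := (Real.strictConcaveOn_rpow hr0 hr).2 ha hb hab one_half_pos one_half_pos
    (add_halves 1)
  rw [add_rpow_eq_two_rpow_mul ha hb]
  gcongr
  exact hmid.trans_eq' (by rw [smul_eq_mul, smul_eq_mul]; ring)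

end RpowComparison

theorem integral_eq_iff_ae_of_lt_or_gt {α : Type*} [MeasurableSpace α] {μ : Measure α}
    {f g : α → ℝ} (hf : Integrable f μ) (hg : Integrable g μ) {P : α → Prop}
    (heq : ∀ᵐ s ∂μ, P s → f s = g s)
    (hne : (∀ᵐ s ∂μ, ¬P s → g s < f s) ∨ ∀ᵐ s ∂μ, ¬P s → f s < g s) :
    ∫ s, f s ∂μ = ∫ s, g s ∂μ ↔ ∀ᵐ s ∂μ, P s := by
  have hlt : ∀ {f g : α → ℝ}, Integrable f μ → Integrable g μ → (∀ᵐ s ∂μ, P s → f s = g s) →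
      (∀ᵐ s ∂μ, ¬P s → f s < g s) → (∫ s, f s ∂μ = ∫ s, g s ∂μ ↔ ∀ᵐ s ∂μ, P s) := by
    intro f g hf hg heq hne
    have hle : f ≤ᵐ[μ] g := by
      filter_upwards [heq, hne] with s heq hne
      exact (em (P s)).elim (fun h => (heq h).le) fun h => (hne h).le
    rw [integral_eq_iff_of_ae_le hf hg hle]
    refine Filter.eventually_congr ?_
    filter_upwards [heq, hne] with s heq hne
    exact ⟨fun h => by_contra fun hP => (hne hP).ne h, heq⟩
  rcases hne with hne | hne
  · exact eq_comm.trans (hlt hg hf (heq.mono fun s h hP => (h hP).symm) hne)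
  · exact hlt hf hg heq hne

section Rigidity

variable {α β : Type*} [MeasurableSpace α] [MeasurableSpace β] {μ : Measure α} {ν : Measure β}
  {p q : ℝ≥0∞}

theorem integrable_norm_rpow_Lp {X : Type*} [NormedAddCommGroup X] (hp0 : p ≠ 0) (hp : p ≠ ∞)
    (f : Lp X p μ) : Integrable (fun s => ‖f s‖ ^ p.toReal) μ :=
  (Lp.memLp f).integrable_norm_rpow hp0 hp

theorem integral_norm_rpow_Lp {X : Type*} [NormedAddCommGroup X] (hp0 : p ≠ 0) (hp : p ≠ ∞)
    (f : Lp X p μ) : ∫ s, ‖f s‖ ^ p.toReal ∂μ = ‖f‖ ^ p.toReal := by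
  rw [show ‖f‖ = ‖f‖ₑ.toReal from rfl, ENNReal.toReal_rpow, ← lintegral_enorm_rpow_Lp hp0 hp,
    integral_eq_lintegral_of_nonneg_ae (.of_forall fun s => by positivity)
      (integrable_norm_rpow_Lp hp0 hp f).1]
  simp only [← ofReal_norm, ENNReal.ofReal_rpow_of_nonneg (norm_nonneg _) ENNReal.toReal_nonneg]

theorem norm_add_rpow_of_inf_eq_zero (hq0 : q ≠ 0) (hq : q ≠ ∞) {x y : Lp ℝ q ν}
    (h : x ⊓ y = 0) : ‖x + y‖ ^ q.toReal = ‖x‖ ^ q.toReal + ‖y‖ ^ q.toReal := by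
  have hQ : q.toReal ≠ 0 := (ENNReal.toReal_pos hq0 hq).ne'
  simp only [← integral_norm_rpow_Lp hq0 hq]
  rw [← integral_add (integrable_norm_rpow_Lp hq0 hq x) (integrable_norm_rpow_Lp hq0 hq y)]
  refine integral_congr_ae ?_
  filter_upwards [ae_eq_zero_or_eq_zero h, Lp.coeFn_add x y] with t ht hadd
  rw [hadd, Pi.add_apply]
  rcases ht with h0 | h0 <;> simp [h0, hQ]

variable [Fact (1 ≤ q)]

theorem ae_norm_add_rpow_of_inf_eq_zero (hq : q ≠ ∞) {x y : Lp (Lp ℝ q ν) p μ} (h : x ⊓ y = 0) :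
    ∀ᵐ s ∂μ, ‖(x + y) s‖ ^ p.toReal =
      (‖x s‖ ^ q.toReal + ‖y s‖ ^ q.toReal) ^ (p.toReal / q.toReal) := by
  have hq0 : q ≠ 0 := (zero_lt_one.trans_le (Fact.out : 1 ≤ q)).ne'
  filter_upwards [inf_eq_zero_iff_ae.1 h, Lp.coeFn_add x y] with s hs hadd
  rw [hadd, Pi.add_apply, ← norm_add_rpow_of_inf_eq_zero hq0 hq hs,
    ← Real.rpow_mul (norm_nonneg _), mul_div_cancel₀ _ (ENNReal.toReal_pos hq0 hq).ne']

theorem norm_rpow_rpow_div (hq : q ≠ ∞) {X : Type*} [NormedAddCommGroup X] (c : X) :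
    (‖c‖ ^ q.toReal) ^ (p.toReal / q.toReal) = ‖c‖ ^ p.toReal := by
  have hq0 : q ≠ 0 := (zero_lt_one.trans_le (Fact.out : 1 ≤ q)).ne'
  rw [← Real.rpow_mul (norm_nonneg _), mul_div_cancel₀ _ (ENNReal.toReal_pos hq0 hq).ne']

theorem toReal_div_toReal_ne_one (hp : p ≠ ∞) (hq : q ≠ ∞) (hpq : p ≠ q) :
    p.toReal / q.toReal ≠ 1 := by
  have hq0 : q ≠ 0 := (zero_lt_one.trans_le (Fact.out : 1 ≤ q)).ne'
  rwa [Ne, div_eq_one_iff_eq (ENNReal.toReal_pos hq0 hq).ne', ENNReal.toReal_eq_toReal_iff' hp hq]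

variable [Fact (1 ≤ p)]

theorem norm_add_rpow_eq_iff_ae_eq_zero (hp : p ≠ ∞) (hq : q ≠ ∞) (hpq : p ≠ q)
    {x y : Lp (Lp ℝ q ν) p μ} (h : x ⊓ y = 0) :
    ‖x + y‖ ^ p.toReal = ‖x‖ ^ p.toReal + ‖y‖ ^ p.toReal ↔ ∀ᵐ s ∂μ, x s = 0 ∨ y s = 0 := by
  have hp0 : p ≠ 0 := (zero_lt_one.trans_le (Fact.out : 1 ≤ p)).ne'
  have hP : 0 < p.toReal := ENNReal.toReal_pos hp0 hp
  have hi := fun f : Lp (Lp ℝ q ν) p μ => integrable_norm_rpow_Lp hp0 hp f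
  simp only [← integral_norm_rpow_Lp hp0 hp]
  rw [← integral_add (hi x) (hi y)]
  have hpos : ∀ c : Lp ℝ q ν, c ≠ 0 → 0 < ‖c‖ ^ q.toReal := fun c hc =>
    Real.rpow_pos_of_pos (norm_pos_iff.2 hc) _
  have hadd := ae_norm_add_rpow_of_inf_eq_zero hq h
  refine integral_eq_iff_ae_of_lt_or_gt (hi _) ((hi x).add (hi y)) ?_ <|
    (toReal_div_toReal_ne_one hp hq hpq).lt_or_gt.symm.imp (fun hr => ?_) fun hr => ?_
  · filter_upwards [Lp.coeFn_add x y] with s hs hxy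
    rw [hs, Pi.add_apply]
    rcases hxy with h0 | h0 <;> simp [h0, hP.ne']
  · filter_upwards [hadd] with s hs hxy
    rw [not_or] at hxy
    rw [hs, Pi.add_apply, ← norm_rpow_rpow_div (p := p) hq (x s),
      ← norm_rpow_rpow_div (p := p) hq (y s)]
    exact rpow_add_rpow_lt_add_rpow (hpos _ hxy.1) (hpos _ hxy.2) hr
  · filter_upwards [hadd] with s hs hxy
    rw [not_or] at hxy
    rw [hs, Pi.add_apply, ← norm_rpow_rpow_div (p := p) hq (x s),
      ← norm_rpow_rpow_div (p := p) hq (y s)]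
    exact add_rpow_lt_rpow_add_rpow (hpos _ hxy.1) (hpos _ hxy.2) hr

theorem norm_add_rpow_eq_iff_ae_norm_eq (hp : p ≠ ∞) (hq : q ≠ ∞) (hpq : p ≠ q)
    {x y : Lp (Lp ℝ q ν) p μ} (h : x ⊓ y = 0) :
    ‖x + y‖ ^ p.toReal =
        2 ^ (p.toReal / q.toReal) * ((‖x‖ ^ p.toReal + ‖y‖ ^ p.toReal) / 2) ↔
      ∀ᵐ s ∂μ, ‖x s‖ = ‖y s‖ := by
  have hp0 : p ≠ 0 := (zero_lt_one.trans_le (Fact.out : 1 ≤ p)).ne'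
  have hq0 : q ≠ 0 := (zero_lt_one.trans_le (Fact.out : 1 ≤ q)).ne'
  have hQ : 0 < q.toReal := ENNReal.toReal_pos hq0 hq
  have hr0 : 0 < p.toReal / q.toReal := div_pos (ENNReal.toReal_pos hp0 hp) hQ
  have hi := fun f : Lp (Lp ℝ q ν) p μ => integrable_norm_rpow_Lp hp0 hp f
  simp only [← integral_norm_rpow_Lp hp0 hp]
  rw [← integral_add (hi x) (hi y), ← integral_div, ← integral_const_mul]
  have hne : ∀ c d : Lp ℝ q ν, ¬‖c‖ = ‖d‖ → ‖c‖ ^ q.toReal ≠ ‖d‖ ^ q.toReal := fun c d hcd =>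
    (Real.rpow_left_inj (norm_nonneg _) (norm_nonneg _) hQ.ne').not.2 hcd
  have hadd := ae_norm_add_rpow_of_inf_eq_zero hq h
  refine integral_eq_iff_ae_of_lt_or_gt (hi _) ((((hi x).add (hi y)).div_const _).const_mul _) ?_ <|
    (toReal_div_toReal_ne_one hp hq hpq).lt_or_gt.imp (fun hr => ?_) fun hr => ?_
  all_goals
    filter_upwards [hadd] with s hs hxy
    rw [hs, Pi.add_apply, ← norm_rpow_rpow_div (p := p) hq (x s),
      ← norm_rpow_rpow_div (p := p) hq (y s)]
  · rw [hxy, ← two_mul, Real.mul_rpow zero_le_two (by positivity), add_self_div_two]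
  · exact two_rpow_mul_lt_add_rpow (by positivity) (by positivity) (hne _ _ hxy) hr0 hr
  · exact add_rpow_lt_two_rpow_mul (by positivity) (by positivity) (hne _ _ hxy) hr

end Rigidity

section Atoms

variable {E : Type*} [AddCommGroup E] [Lattice E]

theorem notMem_of_forall_inf_eq_zero {s : Set E} {z : E} (hz : 0 < z)
    (hzs : ∀ x ∈ s, z ⊓ x = 0) : z ∉ s := fun hmem => hz.ne' (by simpa using hzs z hmem)

/-- A set of pairwise disjoint positive elements of a vector lattice. -/
structure IsDisjointSystem (s : Set E) : Prop where
  pos : ∀ x ∈ s, 0 < x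
  inf_eq_zero : s.Pairwise fun x y => x ⊓ y = 0

namespace IsDisjointSystem

variable {s : Set E}

theorem mono {t : Set E} (hs : IsDisjointSystem s) (hts : t ⊆ s) : IsDisjointSystem t :=
  ⟨fun x hx => hs.pos x (hts hx), hs.inf_eq_zero.mono hts⟩

protected theorem insert (hs : IsDisjointSystem s) {z : E} (hz : 0 < z) (hzs : ∀ x ∈ s, z ⊓ x = 0) :
    IsDisjointSystem (insert z s) :=
  ⟨forall_mem_insert.2 ⟨hz, hs.pos⟩, hs.inf_eq_zero.insert fun x hx _ =>
    ⟨hzs x hx, inf_comm z x ▸ hzs x hx⟩⟩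

theorem eq_zero_of_card_max {s : Finset E} (hs : IsDisjointSystem (s : Set E))
    (hmax : ∀ t : Finset E, IsDisjointSystem (t : Set E) → t.card ≤ s.card) {z : E} (hz : 0 ≤ z)
    (hzs : ∀ x ∈ s, z ⊓ x = 0) : z = 0 := by
  classical
  by_contra hne
  have hzpos := hz.lt_of_ne' hne
  have hcard := hmax (insert z s) (by simpa using hs.insert hzpos hzs)
  rw [Finset.card_insert_of_notMem (notMem_of_forall_inf_eq_zero hzpos hzs)] at hcard
  exact hcard.not_gt s.card.lt_succ_self

theorem eq_zero_or_eq_zero_of_card_max {s : Finset E} (hs : IsDisjointSystem (s : Set E))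
    (hmax : ∀ t : Finset E, IsDisjointSystem (t : Set E) → t.card ≤ s.card) {e a b : E}
    (he : e ∈ s) (ha : 0 ≤ a) (hae : a ≤ e) (hb : 0 ≤ b) (hbe : b ≤ e) (hab : a ⊓ b = 0) :
    a = 0 ∨ b = 0 := by
  classical
  refine or_iff_not_imp_right.2 fun hb0 => ?_
  have hdisj : ∀ c, 0 ≤ c → c ≤ e → ∀ x ∈ s.erase e, c ⊓ x = 0 := fun c hc hce x hx =>
    inf_eq_zero_of_le_left (hs.inf_eq_zero he (Finset.mem_of_mem_erase hx)
      (Finset.ne_of_mem_erase hx).symm) hc hce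
  have hs' : IsDisjointSystem (s.erase e : Set E) := hs.mono (s.erase_subset e)
  have hbpos := hb.lt_of_ne' hb0
  have hcard : (insert b (s.erase e)).card = s.card := by
    rw [Finset.card_insert_of_notMem (notMem_of_forall_inf_eq_zero hbpos (hdisj b hb hbe)),
      Finset.card_erase_add_one he]
  exact eq_zero_of_card_max (s := insert b (s.erase e))
    (by simpa using hs'.insert hbpos (hdisj b hb hbe)) (fun t ht => hcard ▸ hmax t ht) ha
    ((Finset.forall_mem_insert _ _ _).2 ⟨hab, hdisj a ha hae⟩)

variable [IsOrderedAddMonoid E] [Module ℝ E] [IsOrderedModule ℝ E]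

theorem linearIndependent (hs : IsDisjointSystem s) :
    LinearIndependent ℝ ((↑) : s → E) := by
  classical
  rw [linearIndependent_iff']
  intro t g hg i hi
  rw [← Finset.add_sum_erase t _ hi] at hg
  have hle : |g i| • (i : E) ≤ ∑ j ∈ t.erase i, |g j| • (j : E) := by
    rcases abs_choice (g i) with h | h
    · rw [h, eq_neg_of_add_eq_zero_left hg, ← Finset.sum_neg_distrib]
      refine Finset.sum_le_sum fun j _ => ?_
      rw [← neg_smul]
      exact smul_le_smul_of_nonneg_right (neg_le_abs _) (hs.pos j j.2).le
    · rw [h, neg_smul, neg_eq_of_add_eq_zero_right hg]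
      exact Finset.sum_le_sum fun j _ =>
        smul_le_smul_of_nonneg_right (le_abs_self _) (hs.pos j j.2).le
  have hdisj : (∑ j ∈ t.erase i, |g j| • (j : E)) ⊓ |g i| • (i : E) = 0 :=
    sum_inf_eq_zero (smul_nonneg (abs_nonneg _) (hs.pos i i.2).le) fun j hj =>
      smul_inf_smul_eq_zero (hs.inf_eq_zero j.2 i.2
        (Subtype.coe_injective.ne (Finset.ne_of_mem_erase hj))) (abs_nonneg _) (abs_nonneg _)
  rw [inf_eq_right.2 hle, smul_eq_zero] at hdisj
  exact abs_eq_zero.1 (hdisj.resolve_right (hs.pos i i.2).ne')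

variable (E) in
theorem exists_card_max [FiniteDimensional ℝ E] :
    ∃ s : Finset E, IsDisjointSystem (s : Set E) ∧
      ∀ t : Finset E, IsDisjointSystem (t : Set E) → t.card ≤ s.card := by
  let S : Set ℕ := {n | ∃ s : Finset E, IsDisjointSystem (s : Set E) ∧ s.card = n}
  have hne : S.Nonempty := ⟨0, ∅, ⟨by simp, by simp⟩, rfl⟩
  have hbdd : BddAbove S := by
    refine ⟨Module.finrank ℝ E, ?_⟩
    rintro _ ⟨s, hs, rfl⟩
    exact hs.linearIndependent.finset_card_le_finrank
  obtain ⟨s, hs, hcard⟩ := Nat.sSup_mem hne hbdd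
  exact ⟨s, hs, fun t ht => hcard ▸ le_csSup hbdd ⟨t, ht, rfl⟩⟩

end IsDisjointSystem

/-- An atom of a vector lattice: a positive element whose order interval from `0` consists of its
multiples. It need not be an `IsAtom` of the order. -/
structure IsLatticeAtom [Module ℝ E] (e : E) : Prop where
  pos : 0 < e
  exists_eq_smul : ∀ y, 0 ≤ y → y ≤ e → ∃ t : ℝ, y = t • e

theorem IsLatticeAtom.smul [IsOrderedAddMonoid E] [Module ℝ E] [IsOrderedModule ℝ E] {e : E}
    (he : IsLatticeAtom e) {c : ℝ} (hc : 0 < c) : IsLatticeAtom (c • e) := by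
  refine ⟨(smul_nonneg hc.le he.pos.le).lt_of_ne' (smul_ne_zero hc.ne' he.pos.ne'),
    fun y hy0 hy => ?_⟩
  obtain ⟨t, ht⟩ := he.exists_eq_smul (c⁻¹ • y) (smul_nonneg (inv_nonneg.2 hc.le) hy0)
    ((inv_smul_le_iff_of_pos hc).2 hy)
  exact ⟨t, by rw [smul_comm, ← ht, smul_inv_smul₀ hc.ne']⟩

end Atoms

section FiniteDimensionalLattice

variable {E : Type*} [NormedAddCommGroup E] [NormedSpace ℝ E] [Lattice E] [HasSolidNorm E]
  [IsOrderedAddMonoid E] [IsOrderedModule ℝ E]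

theorem isLatticeAtom_of_forall_inf_eq_zero {e : E} (he : 0 < e)
    (h : ∀ a b, 0 ≤ a → a ≤ e → 0 ≤ b → b ≤ e → a ⊓ b = 0 → a = 0 ∨ b = 0) :
    IsLatticeAtom e := by
  refine ⟨he, fun y hy0 hy => ?_⟩
  have hcover : Icc (0 : ℝ) 1 ⊆ {t | t • e ≤ y} ∪ {t | y ≤ t • e} := by
    intro t ht
    have hte : 0 ≤ t • e := smul_nonneg ht.1 he.le
    refine (h (y - t • e)⁺ (y - t • e)⁻ (posPart_nonneg _) (sup_le ?_ he.le) (negPart_nonneg _)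
      (sup_le ?_ he.le) (posPart_inf_negPart_eq_zero _)).symm.imp (fun h0 => ?_) fun h0 => ?_
    · exact (sub_le_self y hte).trans hy
    · rw [neg_sub]
      exact (sub_le_self _ hy0).trans (smul_le_of_le_one_left he.le ht.2)
    · exact sub_nonneg.1 (negPart_eq_zero.1 h0)
    · exact sub_nonpos.1 (posPart_eq_zero.1 h0)
  obtain ⟨t, -, hty, hyt⟩ := isPreconnected_closed_iff.1 isPreconnected_Icc _ _
    (isClosed_le (by fun_prop) continuous_const) (isClosed_le continuous_const (by fun_prop)) hcover
    ⟨0, ⟨le_rfl, zero_le_one⟩, by simpa using hy0⟩ ⟨1, ⟨zero_le_one, le_rfl⟩, by simpa using hy⟩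
  exact ⟨t, le_antisymm hyt hty⟩

theorem IsLatticeAtom.exists_sub_smul_inf_eq_zero {e : E} (he : IsLatticeAtom e) {x : E}
    (hx : 0 ≤ x) : ∃ a : ℝ, 0 ≤ a ∧ a • e ≤ x ∧ (x - a • e) ⊓ e = 0 := by
  have hcompact : IsCompact {a : ℝ | 0 ≤ a ∧ a • e ≤ x} := by
    refine (isCompact_Icc (b := ‖x‖ / ‖e‖)).of_isClosed_subset (isClosed_Ici.inter
      (isClosed_le (by fun_prop) continuous_const)) fun a ⟨ha0, hax⟩ => ⟨ha0, ?_⟩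
    rw [le_div_iff₀ (norm_pos_iff.2 he.pos.ne'), ← Real.norm_of_nonneg ha0, ← norm_smul]
    refine norm_le_norm_of_abs_le_abs ?_
    rwa [abs_of_nonneg (smul_nonneg ha0 he.pos.le), abs_of_nonneg hx]
  obtain ⟨a, ⟨ha0, hax⟩, hmax⟩ := hcompact.exists_isGreatest ⟨0, le_rfl, by simpa using hx⟩
  have hinf : 0 ≤ (x - a • e) ⊓ e := le_inf (sub_nonneg.2 hax) he.pos.le
  obtain ⟨t, ht⟩ := he.exists_eq_smul _ hinf inf_le_right
  have hat : (a + t) • e ≤ x := by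
    rw [add_smul, ← ht, ← le_sub_iff_add_le']
    exact inf_le_left
  have ht0 : t ≤ 0 := by
    by_contra! htpos
    linarith [hmax ⟨add_nonneg ha0 htpos.le, hat⟩]
  exact ⟨a, ha0, hax, hinf.antisymm' (ht ▸ smul_nonpos_of_nonpos_of_nonneg ht0 he.pos.le)⟩

theorem exists_sub_mem_span_inf_eq_zero {s : Finset E} (hs : ∀ e ∈ s, IsLatticeAtom e) {x : E}
    (hx : 0 ≤ x) :
    ∃ z, 0 ≤ z ∧ x - z ∈ Submodule.span ℝ (s : Set E) ∧ ∀ e ∈ s, z ⊓ e = 0 := by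
  classical
  induction s using Finset.induction_on with
  | empty => exact ⟨x, hx, by simp, by simp⟩
  | insert e s _ ih =>
    obtain ⟨z, hz0, hxz, hzs⟩ := ih fun c hc => hs c (Finset.mem_insert_of_mem hc)
    obtain ⟨a, ha0, haz, hze⟩ :=
      (hs e (Finset.mem_insert_self e s)).exists_sub_smul_inf_eq_zero hz0
    have he0 := (hs e (Finset.mem_insert_self e s)).pos.le
    refine ⟨z - a • e, sub_nonneg.2 haz, ?_, (Finset.forall_mem_insert _ _ _).2 ⟨hze, fun c hc =>
      inf_eq_zero_of_le_left (hzs c hc) (sub_nonneg.2 haz) (sub_le_self z (smul_nonneg ha0 he0))⟩⟩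
    rw [sub_sub_eq_add_sub, add_sub_right_comm, Finset.coe_insert]
    exact add_mem (Submodule.span_mono (subset_insert e s) hxz)
      (Submodule.smul_mem _ a (Submodule.subset_span (mem_insert e _)))

theorem IsDisjointSystem.span_eq_top {s : Finset E} (hs : IsDisjointSystem (s : Set E))
    (hmax : ∀ t : Finset E, IsDisjointSystem (t : Set E) → t.card ≤ s.card)
    (hatom : ∀ e ∈ s, IsLatticeAtom e) : Submodule.span ℝ (s : Set E) = ⊤ := by
  have hpos : ∀ x : E, 0 ≤ x → x ∈ Submodule.span ℝ (s : Set E) := fun x hx => by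
    obtain ⟨z, hz0, hxz, hzs⟩ := exists_sub_mem_span_inf_eq_zero hatom hx
    rwa [hs.eq_zero_of_card_max hmax hz0 hzs, sub_zero] at hxz
  refine eq_top_iff.2 fun x _ => ?_
  rw [← posPart_sub_negPart x]
  exact sub_mem (hpos _ (posPart_nonneg x)) (hpos _ (negPart_nonneg x))

theorem exists_basis_isLatticeAtom (E : Type*) [NormedAddCommGroup E] [NormedSpace ℝ E] [Lattice E]
    [HasSolidNorm E] [IsOrderedAddMonoid E] [IsOrderedModule ℝ E] [FiniteDimensional ℝ E] :
    ∃ (s : Finset E) (b : Module.Basis s ℝ E), (∀ i, IsLatticeAtom (b i)) ∧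
      (∀ i, ‖b i‖ = 1) ∧ Pairwise fun i j => b i ⊓ b j = 0 := by
  obtain ⟨s, hs, hmax⟩ := IsDisjointSystem.exists_card_max E
  have hatom : ∀ e ∈ s, IsLatticeAtom e := fun e he =>
    isLatticeAtom_of_forall_inf_eq_zero (hs.pos e he) fun _ _ =>
      hs.eq_zero_or_eq_zero_of_card_max hmax he
  have hnorm : ∀ i : s, ‖(i : E)‖ ≠ 0 := fun i => norm_ne_zero_iff.2 (hs.pos i i.2).ne'
  let b := (Module.Basis.mk hs.linearIndependent
    (by simpa using (hs.span_eq_top hmax hatom).ge)).isUnitSMul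
      (w := fun i : s => ‖(i : E)‖⁻¹) fun i => (inv_ne_zero (hnorm i)).isUnit
  have hb : ∀ i, b i = ‖(i : E)‖⁻¹ • (i : E) := fun i => by
    simp only [b, Module.Basis.isUnitSMul_apply, Module.Basis.mk_apply]
  refine ⟨s, b, fun i => ?_, fun i => ?_, fun i j hij => ?_⟩
  · rw [hb]
    exact (hatom i i.2).smul (inv_pos.2 ((norm_nonneg _).lt_of_ne' (hnorm i)))
  · rw [hb, norm_smul, norm_inv, norm_norm, inv_mul_cancel₀ (hnorm i)]
  · simp only [hb]
    exact smul_inf_smul_eq_zero (hs.inf_eq_zero i.2 j.2 (Subtype.coe_injective.ne hij))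
      (by positivity) (by positivity)

end FiniteDimensionalLattice

section BaseIndecomposable

variable {α : Type*} [MeasurableSpace α] {μ : Measure α} {p : ℝ≥0∞} {X Y : Type*}
  [NormedAddCommGroup X] [NormedAddCommGroup Y]

/-- A function that cannot be cut into two nonzero pieces by a measurable subset of the base. -/
def IsBaseIndecomposable (x : Lp X p μ) : Prop :=
  ∀ A, MeasurableSet A → (∀ᵐ s ∂μ, s ∈ A → x s = 0) ∨ ∀ᵐ s ∂μ, s ∉ A → x s = 0

namespace IsBaseIndecomposable

theorem exists_norm_eq_const_mul {x : Lp X p μ} (hx : IsBaseIndecomposable x) (y : Lp Y p μ) :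
    ∃ c : ℝ, ∀ᵐ s ∂μ, x s ≠ 0 → ‖y s‖ = c * ‖x s‖ := by
  have hsupp : MeasurableSet {s | x s ≠ 0} := (Lp.stronglyMeasurable x).measurableSet_support
  have hratio : Measurable fun s => ‖y s‖ / ‖x s‖ :=
    (Lp.stronglyMeasurable y).norm.measurable.div (Lp.stronglyMeasurable x).norm.measurable
  obtain ⟨c, hc⟩ := Filter.exists_eventuallyEq_const_of_forall_separating
    (l := ae (μ.restrict {s | x s ≠ 0})) (f := fun s => ‖y s‖ / ‖x s‖) MeasurableSet
    fun U hU => by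
      rw [ae_restrict_iff' hsupp, ae_restrict_iff' hsupp]
      exact (hx _ (hratio hU)).symm.imp
        (fun h => h.mono fun s hs hxs => not_not.1 fun hsU => hxs (hs hsU))
        fun h => h.mono fun s hs hxs hsU => hxs (hs hsU)
  refine ⟨c, ((ae_restrict_iff' hsupp).1 hc).mono fun s hs hxs => ?_⟩
  exact (div_eq_iff (norm_ne_zero_iff.2 hxs)).1 (hs hxs)

theorem ae_eq_zero_or_ae_norm_eq [NormedSpace ℝ X] [Fact (1 ≤ p)] {x : Lp X p μ} {y : Lp Y p μ}
    (hx : IsBaseIndecomposable x) (hy : IsBaseIndecomposable y) (hxy : ‖x‖ = ‖y‖) :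
    (∀ᵐ s ∂μ, x s = 0 ∨ y s = 0) ∨ ∀ᵐ s ∂μ, ‖x s‖ = ‖y s‖ := by
  rcases hy _ (Lp.stronglyMeasurable x).measurableSet_support with hdisj | hsub
  · exact Or.inl (hdisj.mono fun s hs => or_iff_not_imp_left.2 hs)
  right
  obtain ⟨c, hc⟩ := hx.exists_norm_eq_const_mul y
  have hprop : ∀ᵐ s ∂μ, ‖y s‖ = |c| * ‖x s‖ := by
    filter_upwards [hc, hsub] with s hcs hsubs
    by_cases hxs : x s = 0
    · rw [hsubs (not_not.2 hxs), hxs, norm_zero, norm_zero, mul_zero]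
    · rw [← abs_norm (y s), hcs hxs, abs_mul, abs_norm]
  have hnorm : ‖x‖ = |c| * ‖x‖ := by
    rw [← Real.norm_eq_abs, ← norm_smul, hxy]
    refine norm_eq_of_ae_norm_eq ?_
    filter_upwards [hprop, Lp.coeFn_smul c x] with s hs hsmul
    rw [hs, hsmul, Pi.smul_apply, norm_smul, Real.norm_eq_abs]
  rcases eq_or_ne ‖x‖ 0 with hx0 | hx0
  · rw [norm_eq_zero.1 hx0, norm_eq_zero.1 (hxy.symm.trans hx0)]
    filter_upwards [Lp.coeFn_zero X p μ, Lp.coeFn_zero Y p μ] with s hs hs'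
    rw [hs, hs', Pi.zero_apply, Pi.zero_apply, norm_zero, norm_zero]
  · filter_upwards [hprop] with s hs
    rw [hs, (mul_eq_right₀ hx0).1 hnorm.symm, one_mul]

end IsBaseIndecomposable

end BaseIndecomposable

section LatticeEmbedding

variable {E F : Type*} [NormedAddCommGroup E] [NormedSpace ℝ E] [Lattice E]
  [NormedAddCommGroup F] [NormedSpace ℝ F] [Lattice F]

theorem PreservesLattice.le_iff {T : E →ₗᵢ[ℝ] F} (hT : PreservesLattice T) {a b : E} :
    T a ≤ T b ↔ a ≤ b := by
  rw [← inf_eq_left, ← hT.2, T.injective.eq_iff, inf_eq_left]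

theorem PreservesLattice.map_nonneg_iff {T : E →ₗᵢ[ℝ] F} (hT : PreservesLattice T) {a : E} :
    0 ≤ T a ↔ 0 ≤ a := by
  rw [← hT.le_iff, map_zero]

theorem PreservesLattice.map_inf_eq_zero {T : E →ₗᵢ[ℝ] F} (hT : PreservesLattice T) {a b : E}
    (hab : a ⊓ b = 0) : T a ⊓ T b = 0 := by
  rw [← hT.2, hab, map_zero]

theorem IsLatticeAtom.isBaseIndecomposable {α X : Type*} [MeasurableSpace α] {μ : Measure α}
    {p : ℝ≥0∞} [Fact (1 ≤ p)] [NormedAddCommGroup X] [NormedSpace ℝ X] [Lattice X]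
    [HasSolidNorm X] [IsOrderedAddMonoid X] {T : E →ₗᵢ[ℝ] Lp X p μ} (hT : PreservesLattice T)
    (hsolid : LatticeOrderedAddCommGroup.IsSolid (range T)) {e : E} (he : IsLatticeAtom e) :
    IsBaseIndecomposable (T e) := by
  intro A hA
  have hTe : 0 ≤ T e := hT.map_nonneg_iff.2 he.pos.le
  have hTe_ae := (Lp.coeFn_nonneg (T e)).2 hTe
  have hz := ((Lp.memLp (T e)).indicator hA).coeFn_toLp
  set z := ((Lp.memLp (T e)).indicator hA).toLp
  have hz0 : 0 ≤ z := by
    rw [← Lp.coeFn_nonneg]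
    filter_upwards [hz, hTe_ae] with s hs hTes
    exact hs ▸ indicator_apply_nonneg fun _ => hTes
  have hze : z ≤ T e := by
    rw [← Lp.coeFn_le]
    filter_upwards [hz, hTe_ae] with s hs hTes
    exact hs ▸ indicator_apply_le' (fun _ => le_rfl) fun _ => hTes
  obtain ⟨y, hy⟩ : z ∈ range T :=
    hsolid ⟨e, rfl⟩ (by rwa [abs_of_nonneg hz0, abs_of_nonneg hTe])
  obtain ⟨t, rfl⟩ := he.exists_eq_smul y (by rwa [← hT.map_nonneg_iff, hy])
    (by rwa [← hT.le_iff, hy])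
  have hcut : ∀ᵐ s ∂μ, t • T e s = A.indicator (T e) s := by
    filter_upwards [hz, Lp.coeFn_smul t (T e)] with s hs hsmul
    rw [← hs, ← hy, map_smul, hsmul, Pi.smul_apply]
  rcases eq_or_ne t 1 with rfl | ht
  · refine Or.inr (hcut.mono fun s hs hsA => ?_)
    rwa [indicator_of_notMem hsA, one_smul] at hs
  · refine Or.inl (hcut.mono fun s hs hsA => ?_)
    rw [indicator_of_mem hsA] at hs
    exact (smul_eq_zero.1 (by rw [sub_smul, hs, one_smul, sub_self])).resolve_left
      (sub_ne_zero.2 ht)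

end LatticeEmbedding

section CommonStructure

variable {E : Type*} [NormedAddCommGroup E] [NormedSpace ℝ E] [Lattice E] {p q : ℝ≥0∞}
  [Fact (1 ≤ p)] [Fact (1 ≤ q)] {α β α' β' : Type*} [MeasurableSpace α] [MeasurableSpace β]
  [MeasurableSpace α'] [MeasurableSpace β'] {μ : Measure α} {ν : Measure β} {μ' : Measure α'}
  {ν' : Measure β'} {S : E →ₗᵢ[ℝ] Lp (Lp ℝ q ν) p μ} {T : E →ₗᵢ[ℝ] Lp (Lp ℝ q ν') p μ'} {a b : E}

theorem ae_eq_zero_or_eq_zero_iff_of_isometry (hp : p ≠ ∞) (hq : q ≠ ∞) (hpq : p ≠ q)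
    (hS : PreservesLattice S) (hT : PreservesLattice T) (hab : a ⊓ b = 0) :
    (∀ᵐ s ∂μ, S a s = 0 ∨ S b s = 0) ↔ ∀ᵐ s ∂μ', T a s = 0 ∨ T b s = 0 := by
  rw [← norm_add_rpow_eq_iff_ae_eq_zero hp hq hpq (hS.map_inf_eq_zero hab),
    ← norm_add_rpow_eq_iff_ae_eq_zero hp hq hpq (hT.map_inf_eq_zero hab)]
  simp only [← map_add, LinearIsometry.norm_map]

theorem ae_norm_eq_iff_of_isometry (hp : p ≠ ∞) (hq : q ≠ ∞) (hpq : p ≠ q)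
    (hS : PreservesLattice S) (hT : PreservesLattice T) (hab : a ⊓ b = 0) :
    (∀ᵐ s ∂μ, ‖S a s‖ = ‖S b s‖) ↔ ∀ᵐ s ∂μ', ‖T a s‖ = ‖T b s‖ := by
  rw [← norm_add_rpow_eq_iff_ae_norm_eq hp hq hpq (hS.map_inf_eq_zero hab),
    ← norm_add_rpow_eq_iff_ae_norm_eq hp hq hpq (hT.map_inf_eq_zero hab)]
  simp only [← map_add, LinearIsometry.norm_map]

end CommonStructure

section BlockStructure

variable {p q : ℝ≥0∞} {ι K : Type*}

theorem exists_isBlockFrame [Nonempty ι] {κ : ι → K} {x : ι → Lp ℝ q lebesgueUnit}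
    (hx0 : ∀ i, 0 ≤ x i) (hdisj : Pairwise fun i j => x i ⊓ x j = 0)
    (hsame : ∀ i j, κ i = κ j → ‖x i‖ = ‖x j‖) (hdiff : ∀ i j, κ i ≠ κ j → x i = 0 ∨ x j = 0) :
    ∃ k c, IsBlockFrame κ k c x := by
  by_cases hzero : ∀ i, x i = 0
  · exact ⟨κ (Classical.arbitrary ι), 0, fun i _ => hzero i,
      fun i _ => by rw [hzero i, Lp.norm_zero], hx0, hdisj⟩
  · obtain ⟨i, hi⟩ := not_forall.1 hzero
    exact ⟨κ i, ‖x i‖, fun j hj => (hdiff j i hj).resolve_right hi, fun j hj => hsame j i hj, hx0,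
      hdisj⟩

variable [Fact (1 ≤ p)] [Fact (1 ≤ q)]

theorem ae_exists_isBlockFrame [Countable ι] [Nonempty ι] {κ : ι → K} {x : ι → LpLq p q}
    (hx0 : ∀ i, 0 ≤ x i) (hdisj : Pairwise fun i j => x i ⊓ x j = 0)
    (hsame : ∀ i j, κ i = κ j → ∀ᵐ s ∂lebesgueUnit, ‖x i s‖ = ‖x j s‖)
    (hdiff : ∀ i j, κ i ≠ κ j → ∀ᵐ s ∂lebesgueUnit, x i s = 0 ∨ x j s = 0) :
    ∀ᵐ s ∂lebesgueUnit, ∃ k c, IsBlockFrame κ k c fun i => x i s := by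
  have hx0' : ∀ᵐ s ∂lebesgueUnit, ∀ i, 0 ≤ x i s :=
    ae_all_iff.2 fun i => (Lp.coeFn_nonneg (x i)).2 (hx0 i)
  have hdisj' : ∀ᵐ s ∂lebesgueUnit, Pairwise fun i j => x i s ⊓ x j s = 0 := by
    simp only [Pairwise, ae_all_iff, Filter.eventually_imp_distrib_left]
    exact fun i j hij => inf_eq_zero_iff_ae.1 (hdisj hij)
  simp only [← Filter.eventually_imp_distrib_left, ← ae_all_iff] at hsame hdiff
  filter_upwards [hx0', hdisj', hsame, hdiff] with s h0 hd hs hdf using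
    exists_isBlockFrame h0 hd hs hdf

end BlockStructure

section Main

variable {E : Type u} [NormedAddCommGroup E] [NormedSpace ℝ E] [Lattice E] [IsOrderedAddMonoid E]
  [IsOrderedModule ℝ E] [HasSolidNorm E] {p q : ℝ≥0∞} [Fact (1 ≤ p)] [Fact (1 ≤ q)]

theorem IsFinDimBLpLq.exists_basis_ae_isBlockFrame [Nontrivial E] (hp : p ≠ ∞) (hq : q ≠ ∞)
    (hpq : p ≠ q) (hE : IsFinDimBLpLq.{u, v, w} p q E) :
    ∃ (ι K : Type u) (_ : Finite ι) (b : Module.Basis ι ℝ E) (κ : ι → K), Function.Surjective κ ∧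
      (∀ i, ‖b i‖ = 1) ∧ ∀ f : E →ₗᵢ[ℝ] LpLq p q, PreservesLattice f →
        ∀ᵐ s ∂lebesgueUnit, ∃ k c, IsBlockFrame κ k c fun i => f (b i) s := by
  obtain ⟨_, Ω, _, μ, Ω', _, ν, T, hT, hband⟩ := hE
  obtain ⟨ι, b, hatom, hnorm, hdisj⟩ := exists_basis_isLatticeAtom E
  have := b.index_nonempty
  let blocks : Setoid ι :=
    { r := fun i j => ∀ᵐ s ∂μ, ‖T (b i) s‖ = ‖T (b j) s‖
      iseqv := ⟨fun _ => ae_of_all _ fun _ => rfl, fun h => h.mono fun _ => Eq.symm,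
        fun h h' => by filter_upwards [h, h'] with s using Eq.trans⟩ }
  have hindec := fun i => (hatom i).isBaseIndecomposable hT hband.solid
  refine ⟨ι, Quotient blocks, inferInstance, b, Quotient.mk blocks, Quotient.mk_surjective, hnorm,
    fun f hf => ae_exists_isBlockFrame (fun i => hf.map_nonneg_iff.2 (hatom i).pos.le)
      (fun i j hij => hf.map_inf_eq_zero (hdisj hij)) (fun i j hij => ?_) fun i j hij => ?_⟩
  · rcases eq_or_ne i j with rfl | hne
    · exact ae_of_all _ fun _ => rfl
    · exact (ae_norm_eq_iff_of_isometry hp hq hpq hf hT (hdisj hne)).2 (Quotient.exact hij)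
  · have hne : i ≠ j := fun h => hij (congrArg _ h)
    refine (ae_eq_zero_or_eq_zero_iff_of_isometry hp hq hpq hf hT (hdisj hne)).2 ?_
    exact ((hindec i).ae_eq_zero_or_ae_norm_eq (hindec j)
      (by rw [T.norm_map, T.norm_map, hnorm, hnorm])).resolve_right fun h => hij (Quotient.sound h)

theorem theoremt_general (hp : p ≠ ∞) (hq : q ≠ ∞) (hpq : p ≠ q)
    (hE : IsFinDimBLpLq.{u, v, w} p q E) {f₁ f₂ : E →ₗᵢ[ℝ] LpLq p q} (hf₁ : PreservesLattice f₁)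
    (hf₂ : PreservesLattice f₂) {ε : ℝ} (hε : 0 < ε) :
    ∃ φ : LpLq p q ≃ₗᵢ[ℝ] LpLq p q, PreservesLattice φ ∧
      ∀ x, ‖φ (f₁ x) - f₂ x‖ ≤ ε * ‖x‖ := by
  rcases subsingleton_or_nontrivial E with _ | _
  · exact ⟨.refl ℝ _, ⟨fun _ _ => rfl, fun _ _ => rfl⟩, fun x => by simp [Subsingleton.elim x 0]⟩
  obtain ⟨ι, K, _, b, κ, hκ, hb, hblock⟩ := hE.exists_basis_ae_isBlockFrame hp hq hpq
  have := b.index_nonempty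
  obtain ⟨C, hC, hbound⟩ := b.exists_opNorm_le (F := LpLq p q)
  obtain ⟨φ, hφ, hφb⟩ := exists_automorphism_of_isBlockFrame hp hq hκ
    (fun i => by rw [f₁.norm_map, hb]) (fun i => by rw [f₂.norm_map, hb]) (hblock f₁ hf₁)
    (hblock f₂ hf₂) (div_pos hε hC)
  refine ⟨φ, hφ, fun x => ?_⟩
  let u : E →L[ℝ] LpLq p q :=
    (φ.toLinearIsometry.comp f₁).toContinuousLinearMap - f₂.toContinuousLinearMap
  calc ‖φ (f₁ x) - f₂ x‖ = ‖u x‖ := rfl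
    _ ≤ C * (ε / C) * ‖x‖ :=
      u.le_of_opNorm_le (hbound (div_pos hε hC).le fun i => (hφb i).le) x
    _ = ε * ‖x‖ := by rw [mul_div_cancel₀ _ hC.ne']

end Main

theorem theoremt (p q : ℝ≥0∞) [Fact (1 ≤ p)] [Fact (1 ≤ q)]
    (hp : p ≠ ∞) (hq : q ≠ ∞) (hpq : p ≠ q) :
    IsAUH.{0, u} (LpLq p q) (fun E _ _ _ => IsFinDimBLpLq.{u, v, w} p q E) := by
  intro E _ _ _ _ _ _ _ hE n e _ f₁ f₂ hf₁ hf₂ ε hε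
  obtain ⟨M, hM, heM⟩ := (finite_range e).isBounded.exists_pos_norm_lt
  obtain ⟨φ, hφ, hφf⟩ := theoremt_general hp hq hpq hE hf₁ hf₂ (div_pos hε hM)
  exact ⟨φ, hφ, fun j => (hφf (e j)).trans_lt ((mul_lt_mul_of_pos_left (heM _ (mem_range_self j))
    (div_pos hε hM)).trans_eq (div_mul_cancel₀ ε hM.ne'))⟩
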